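/- Let $e\in[0,1)$, $T>0$ and $\sigma_e(r)=\frac{1-e}{4}r$. Write $\mathbb R^2_{\neq}=\{(v,v_*)\in\mathbb R^2: v\neq v_*\}$ and $\tilde\nabla\varphi(v,v_*)=\varphi'(v_*)-\varphi'(v)$. Let $\mathcal P_2^{\rm cm}(\mathbb R)$ be the set of Borel probability measures on $\mathbb R$ with finite second moment and mean zero, $\mathcal M(\mathbb R^2_{\neq})$ the set of finite signed Borel measures on $\mathbb R^2_{\neq}$, and $$\mathcal E(f)=\tfrac12\int v^2\,df(v),\qquad \mathcal D(f)=\iint_{\mathbb R^2_{\neq}}|v-v_*|^2\sigma_e(|v-v_*|)\,d(f\otimes f)\in[0,\infty].$$ A pair $(f_t,U_t)_{t\in[0,T]}$ of measurable families $f_t\in\mathcal P(\mathbb R)$, $U_t\in\mathcal M(\mathbb R^2_{\neq})$ belongs to $\mathrm{GCE}_T$ if $\int_0^T\iint\sigma_e(|v-v_*|)\,d|U_t|\,dt<\infty$ and, for every $\varphi\in C_c^1((0,T)\times\mathbb R)$, $$\int_0^T\int_{\mathbb R}\partial_t\varphi_t\,df_t\,dt+\int_0^T\iint_{\mathbb R^2_{\neq}}\sigma_e(|v-v_*|)\,\tilde\nabla\varphi_t(v,v_*)\,dU_t(v,v_*)\,dt=0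 .$$ The action density is $$\mathcal A(f,U)=\iint_{\mathbb R^2_{\neq}}\alpha\Big(\frac{d(f\otimes f)}{d\lambda},\frac{dU}{d\lambda}\Big)\sigma_e(|v-v_*|)\,d\lambda,\qquad \lambda=f\otimes f+|U|,$$ where $\alpha(s,u)=u^2/s$ for $s>0$, $\alpha(0,0)=0$ and $\alpha(0,u)=+\infty$ for $u\ne0$. For $\mu_0,\mu_1\in\mathcal P(\mathbb R)$ let $d_{\mathcal A}(\mu_0,\mu_1)^2$ be the infimum of $\int_0^1\mathcal A(f_t,U_t)\,dt$ over all $(f,U)\in\mathrm{GCE}_1$ with $f$ narrowly continuous on $[0,1]$, $f_0=\mu_0$ and $f_1=\mu_1$ (with $\inf\emptyset=\infty$). A curve $f:[0,T]\to\mathcal P_2^{\rm cm}(\mathbb R)$ is in $AC([0,T];(\mathcal P_2^{\rm cm}(\mathbb R),d_{\mathcal A}))$ if there is $m\in L^2(0,T)$ with $d_{\mathcal A}(f_s,f_t)\le\int_s^t m(r)\,dr$ for all $0\le s\le t\le T$. A curve $f:[0,T]\to\mathcal P_2^{\rm cm}(\mathbb R)$ is a weak solution of the aggregation equation $\partial_tf=\partial_v(f\,\partial_vW*f)$,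 $W(v)=\frac{1-e}{6}|v|^3$, if $(f_t,U_t^{\mathcal E})_{t\in[0,T]}\in\mathrm{GCE}_T$ for the flux $dU^{\mathcal E}_t=-\tilde\nabla\big(\tfrac{v^2}{2}\big)\,d(f_t\otimes f_t)=(v-v_*)\,d(f_t\otimes f_t)$. The De Giorgi functional is $$\mathcal G_T(f)=\mathcal E(f_T)-\mathcal E(f_0)+\frac12\inf_{U:\,(f,U)\in\mathrm{GCE}_T}\int_0^T\mathcal A(f_t,U_t)\,dt+\frac12\int_0^T\mathcal D(f_t)\,dt\in(-\infty,\infty]$$ (again with $\inf\emptyset=\infty$). **Theorem.** A curve $f\in AC([0,T];(\mathcal P_2^{\rm cm}(\mathbb R),d_{\mathcal A}))$ is a weak solution of the aggregation equation if and only if $\mathcal G_T(f)=0$. -/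

import Mathlib

open MeasureTheory Set
open scoped ENNReal

noncomputable section

namespace KineticAggregation

/-- The plane without its diagonal, `{(v, v⋆) : v ≠ v⋆}`, with its Borel structure. -/
abbrev OffDiag : Type := {p : ℝ × ℝ // p.1 ≠ p.2}

/-- The weight `σ_e(|v - v⋆|) = (1 - e)/4 * |v - v⋆|`. -/
def sigma (e : ℝ) (p : OffDiag) : ℝ := (1 - e) / 4 * |p.1.1 - p.1.2|

/-- The nonlocal-local gradient `(v, v⋆) ↦ φ'(v⋆) - φ'(v)`. -/
def nlGrad (φ : ℝ → ℝ) (p : OffDiag) : ℝ := deriv φ p.1.2 - deriv φ p.1.1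

/-- The product measure `f ⊗ f` on the plane without its diagonal. -/
def prodOff (f : ProbabilityMeasure ℝ) : Measure OffDiag :=
  ((f : Measure ℝ).prod (f : Measure ℝ)).comap Subtype.val

/-- Probability measures with finite second moment and centre of mass zero. -/
def P2cm : Set (ProbabilityMeasure ℝ) :=
  {f | Integrable (fun v : ℝ => v ^ 2) (f : Measure ℝ) ∧ ∫ v, v ∂(f : Measure ℝ) = 0}

/-- The kinetic energy `E(f) = 1/2 ∫ v² df` (used for `f` with finite second moment). -/
def kineticEnergy (f : ProbabilityMeasure ℝ) : ℝ := 1 / 2 * ∫ v, v ^ 2 ∂(f : Measure ℝ)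

/-- The first variation `v²/2` of the kinetic energy. -/
def energyVariation (v : ℝ) : ℝ := v ^ 2 / 2

/-- The dissipation `D(f) = ∬ |v - v⋆|² σ_e(|v - v⋆|) d(f ⊗ f) ∈ [0, ∞]`. -/
def dissipation (e : ℝ) (f : ProbabilityMeasure ℝ) : ℝ≥0∞ :=
  ∫⁻ p, ENNReal.ofReal (|p.1.1 - p.1.2| ^ 2 * sigma e p) ∂(prodOff f)

/-- The pair `(f_t, U_t)_{t ∈ [0,T]}` is a weak solution of the generalised continuity equation
`∂_t f + div U = 0`. The fluxes are finite signed Borel measures on the plane without its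
diagonal; measurability in time is with respect to the σ-algebra generated by the
evaluations on Borel sets (the Borel σ-algebra of the weak-star topology). -/
structure IsGCE (e T : ℝ) (f : ℝ → ProbabilityMeasure ℝ) (U : ℝ → SignedMeasure OffDiag) :
    Prop where
  measurable_curve : ∀ B : Set ℝ, MeasurableSet B →
    Measurable fun t : Icc (0 : ℝ) T => (f t : Measure ℝ) B
  measurable_flux : ∀ B : Set OffDiag, MeasurableSet B →
    Measurable fun t : Icc (0 : ℝ) T => U t B
  integrability :
    ∫⁻ t in Icc 0 T, ∫⁻ p, ENNReal.ofReal (sigma e p) ∂(U t).variation < ∞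
  weak_form : ∀ φ : ℝ × ℝ → ℝ, ContDiff ℝ 1 φ → HasCompactSupport φ →
    tsupport φ ⊆ Ioo 0 T ×ˢ univ →
    (∫ t in Icc 0 T, ∫ v, deriv (fun s => φ (s, v)) t ∂(f t : Measure ℝ))
      + (∫ t in Icc 0 T, ∫ᵛ p, sigma e p * nlGrad (fun v => φ (t, v)) p ∂<•(U t)) = 0

/-- The function `α(s, u)`, equal to `u² / s` for `s > 0`, to `0` for `u = 0`, and to `∞` for
`s = 0`, `u ≠ 0`. -/
def alpha (s : ℝ≥0∞) (u : ℝ) : ℝ≥0∞ :=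
  if u = 0 then 0 else if s = 0 then ∞ else ENNReal.ofReal (u ^ 2) / s

/-- The action density `A(f, U) = ∬ α(d(f ⊗ f)/dλ, dU/dλ) σ_e dλ` with `λ = f ⊗ f + |U|`. -/
def action (e : ℝ) (f : ProbabilityMeasure ℝ) (U : SignedMeasure OffDiag) : ℝ≥0∞ :=
  ∫⁻ p, alpha ((prodOff f).rnDeriv (prodOff f + U.variation) p)
      (U.rnDeriv (prodOff f + U.variation) p) * ENNReal.ofReal (sigma e p)
    ∂(prodOff f + U.variation)

/-- The collision transport cost: `d_A(μ₀, μ₁)²` is the infimum of `∫₀¹ A(f_t, U_t) dt` over the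
(narrowly continuous representatives of) solutions of the generalised continuity equation on
`[0,1]` that connect `μ₀` to `μ₁`. -/
def collisionDist (e : ℝ) (μ₀ μ₁ : ProbabilityMeasure ℝ) : ℝ≥0∞ :=
  (⨅ (f : ℝ → ProbabilityMeasure ℝ) (U : ℝ → SignedMeasure OffDiag)
    (_ : IsGCE e 1 f U ∧ ContinuousOn f (Icc 0 1) ∧ f 0 = μ₀ ∧ f 1 = μ₁),
      ∫⁻ t in Icc (0 : ℝ) 1, action e (f t) (U t)) ^ (1 / 2 : ℝ)

/-- `f ∈ AC([0,T]; (P₂^cm(ℝ), d_A))`: a 2-absolutely continuous curve for `d_A`. -/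
def IsACCurve (e T : ℝ) (f : ℝ → ProbabilityMeasure ℝ) : Prop :=
  (∀ t ∈ Icc 0 T, f t ∈ P2cm) ∧
  ∃ m : ℝ → ℝ, MemLp m 2 (volume.restrict (Icc 0 T)) ∧
    ∀ s t : ℝ, 0 ≤ s → s ≤ t → t ≤ T →
      collisionDist e (f s) (f t) ≤ ENNReal.ofReal (∫ r in s..t, m r)

/-- The flux `dU = - nlGrad(v²/2) d(f ⊗ f)` driven by the kinetic energy. -/
def energyFlux (f : ProbabilityMeasure ℝ) : SignedMeasure OffDiag :=
  (prodOff f).withDensityᵥ fun p => -nlGrad energyVariation p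

/-- Weak solutions of the aggregation equation `∂_t f = ∂_v (f ∂_v W ∗ f)`,
`W(v) = (1 - e)/6 * |v|³`: curves in `P₂^cm(ℝ)` that solve the generalised continuity equation
with the flux driven by the kinetic energy. -/
def IsWeakSolution (e T : ℝ) (f : ℝ → ProbabilityMeasure ℝ) : Prop :=
  (∀ t ∈ Icc 0 T, f t ∈ P2cm) ∧ IsGCE e T f (fun t => energyFlux (f t))

/-- The total action `∫₀ᵀ A(f_t, U_t) dt` of a curve, `U` being its flux of least action, that is
the infimum over all fluxes that solve the generalised continuity equation with `f`
(`∞` if there is none). -/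
def curveAction (e T : ℝ) (f : ℝ → ProbabilityMeasure ℝ) : ℝ≥0∞ :=
  ⨅ (U : ℝ → SignedMeasure OffDiag) (_ : IsGCE e T f U),
    ∫⁻ t in Icc 0 T, action e (f t) (U t)

/-- The De Giorgi functional
`G_T(f) = E(f_T) - E(f_0) + 1/2 ∫₀ᵀ A(f_t, U_t) dt + 1/2 ∫₀ᵀ D(f_t) dt ∈ (-∞, ∞]`. -/
def deGiorgi (e T : ℝ) (f : ℝ → ProbabilityMeasure ℝ) : EReal :=
  ((kineticEnergy (f T) - kineticEnergy (f 0) : ℝ) : EReal)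
    + ((curveAction e T f / 2 + (∫⁻ t in Icc 0 T, dissipation e (f t)) / 2 : ℝ≥0∞) : EReal)

end KineticAggregation

end

/-! Write a flux as `U_t = u_t (f_t ⊗ f_t)`. The curve `f` decreases the energy at rate `∬ σ (v -
v⋆) dU_t`, which is the cross term in the expansion of the square `∬ |u_t - (v - v⋆)|² σ d(f_t ⊗
f_t)`. Hence, whenever the action of `U` and the dissipation are finite, `∫ A + ∫ D + 2 (E(f_T) -
E(f_0))` equals the excess action of `U`, which is nonnegative (`IsGCE.action_add_dissipation_eq`).
Twice the De Giorgi functional is then the infimum of the excess over all admissible fluxes, and the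
excess measures the distance from `U` to the energy flux.

If the functional vanishes, there are admissible fluxes of arbitrarily small excess. By Young's
inequality the pairing of a flux with a fixed test function differs from that of the energy flux by
at most `δ B + excess / (4δ)`, so the weak formulation passes to the energy flux itself
(`isGCE_energyFlux`). No minimal flux has to be constructed.

If `f` is a weak solution, its dissipation is first shown to be finite
(`IsWeakSolution.lintegral_dissipation_ne_top`): the equation only gives integrability of a
quadratic quantity in `v - v⋆`, whereas `D` is cubic. The energy then drops by exactly `∫ D`, the
energy flux has action at most `∫ D`, and the identity shows that no admissible flux does better, so
the functional is zero.

The analytic core is the chain rule `IsGCE.kineticEnergy_sub_eq`, since `v²/2` is not an admissible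
test function. It is replaced by Huber functions, whose slopes are bounded and whose derivatives are
1-Lipschitz; these are in turn cut off with uniformly bounded slopes. The weak formulation sees only
the open interval `(0, T)`, so reaching the endpoints needs continuity of `t ↦ ∫ φ df_t` at `0` and
`T`. This is the role of absolute continuity: a small collision distance forces closeness against
test functions (`exists_collisionDist_lt_imp`), because the action controls the flux mass once first
moments are controlled, and first moments grow at most by a multiple of the flux mass. -/

noncomputable section

namespace KineticAggregation

/-! ### Measurable families of signed measures and integration against them. -/

section SignedMeasure

open scoped symmDiff
open ProbabilityTheory Function

variable {α X : Type*} {mα : MeasurableSpace α} {mX : MeasurableSpace X}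

instance isFiniteMeasure_variation (U : SignedMeasure X) : IsFiniteMeasure U.variation := by
  rw [← U.totalVariation_eq_variation]; infer_instance

/-- The set `S` is the positive part of a Hahn decomposition, and one `S` serves all `s`. -/
lemma variation_apply_eq_add (U : SignedMeasure X) : ∃ S, MeasurableSet S ∧ ∀ s, MeasurableSet s →
      U.variation s = ‖U (S ∩ s)‖ₑ + ‖U (Sᶜ ∩ s)‖ₑ := by
  obtain ⟨S, hS, hpos, hneg, hP, hN⟩ := U.toJordanDecomposition_spec
  refine ⟨S, hS, fun s hs => ?_⟩
  have h1 : 0 ≤ U (S ∩ s) :=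
    U.nonneg_of_zero_le_restrict (U.zero_le_restrict_subset hS inter_subset_left hpos)
  have h2 : U (Sᶜ ∩ s) ≤ 0 :=
    U.nonpos_of_restrict_le_zero (U.restrict_le_zero_subset hS.compl inter_subset_left hneg)
  rw [← U.totalVariation_eq_variation, SignedMeasure.totalVariation, Measure.add_apply, hP, hN,
    U.toMeasureOfZeroLE_apply hpos hS hs, U.toMeasureOfLEZero_apply hneg hS.compl hs,
    Real.enorm_of_nonneg h1, ← enorm_neg, Real.enorm_of_nonneg (neg_nonneg.mpr h2),
    ENNReal.ofReal_eq_coe_nnreal, ENNReal.ofReal_eq_coe_nnreal]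

/-- The sets `S ∩ s` and `A ∩ s` differ only inside `A ∆ S`. As `A ∆ S` is unchanged by
complementing both sets, the same error bounds the complementary pair. -/
lemma enorm_apply_le_enorm_add_variation (U : SignedMeasure X) {A S s : Set X}
    (hA : MeasurableSet A) (hS : MeasurableSet S) (hs : MeasurableSet s) :
    ‖U (S ∩ s)‖ₑ ≤ ‖U (A ∩ s)‖ₑ + U.variation (A ∆ S) := by
  have e1 : U (S ∩ s) = U (A ∩ s) - U ((A \ S) ∩ s) + U ((S \ A) ∩ s) := by
    have h1 : S ∩ s = (S ∩ A ∩ s) ∪ ((S \ A) ∩ s) := by grind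
    have h2 : A ∩ s = (S ∩ A ∩ s) ∪ ((A \ S) ∩ s) := by grind
    rw [h1, h2, VectorMeasure.of_union _ ((hS.inter hA).inter hs) ((hS.diff hA).inter hs),
      VectorMeasure.of_union _ ((hS.inter hA).inter hs) ((hA.diff hS).inter hs)]
    · ring
    · rw [Set.disjoint_left]; grind
    · rw [Set.disjoint_left]; grind
  have h3 : U.variation (A ∆ S) = U.variation (A \ S) + U.variation (S \ A) := by
    rw [Set.symmDiff_def, measure_union _ (hS.diff hA)]
    rw [Set.disjoint_left]; grind
  rw [e1, h3, ← add_assoc]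
  refine (enorm_add_le _ _).trans (add_le_add ((enorm_sub_le).trans (add_le_add le_rfl ?_)) ?_)
  · exact (U.enorm_measure_le_variation _).trans (measure_mono inter_subset_left)
  · exact (U.enorm_measure_le_variation _).trans (measure_mono inter_subset_left)

/-- The Hahn set can be approximated in `|U|`-measure by members of a generating algebra. With a
countable algebra, which does not depend on `U`, the variation becomes a countable supremum of
evaluations. -/
lemma variation_apply_eq_iSup (U : SignedMeasure X) {C : Set (Set X)} (hC : IsSetAlgebra C)
    (hgen : mX = MeasurableSpace.generateFrom C) {s : Set X} (hs : MeasurableSet s) :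
    U.variation s = ⨆ A ∈ C, (‖U (A ∩ s)‖ₑ + ‖U (Aᶜ ∩ s)‖ₑ) := by
  have hCm : ∀ A ∈ C, MeasurableSet A := fun A hA =>
    hgen ▸ MeasurableSpace.measurableSet_generateFrom hA
  apply le_antisymm
  · refine ENNReal.le_of_forall_pos_le_add fun ε hε _ => ?_
    obtain ⟨S, hS, hS'⟩ := variation_apply_eq_add U
    obtain ⟨A, hAC, hA⟩ := exists_measure_symmDiff_lt_of_generateFrom_isSetRing (μ := U.variation)
      hC.isSetRing ⟨{univ}, by simp, by simpa using hC.univ_mem, by simp⟩ hgen hS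
      (ε := (ε : ℝ≥0∞) / 2) (by simpa using hε.ne')
    have hAm := hCm A hAC
    have h1 := enorm_apply_le_enorm_add_variation U hAm hS hs
    have h2 := enorm_apply_le_enorm_add_variation U hAm.compl hS.compl hs
    rw [compl_symmDiff_compl] at h2
    calc U.variation s = ‖U (S ∩ s)‖ₑ + ‖U (Sᶜ ∩ s)‖ₑ := hS' s hs
      _ ≤ (‖U (A ∩ s)‖ₑ + ε / 2) + (‖U (Aᶜ ∩ s)‖ₑ + ε / 2) := by
          gcongr
          · exact h1.trans (by gcongr)
          · exact h2.trans (by gcongr)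
      _ = (‖U (A ∩ s)‖ₑ + ‖U (Aᶜ ∩ s)‖ₑ) + ε := by
          rw [add_add_add_comm, ENNReal.add_halves]
      _ ≤ _ := by
          gcongr
          exact le_iSup₂ (f := fun A _ => ‖U (A ∩ s)‖ₑ + ‖U (Aᶜ ∩ s)‖ₑ) A hAC
  · refine iSup₂_le fun A hA => ?_
    have := hCm A hA
    calc _ ≤ U.variation (A ∩ s) + U.variation (Aᶜ ∩ s) :=
          add_le_add (U.enorm_measure_le_variation _) (U.enorm_measure_le_variation _)
      _ = U.variation s := by
          rw [inter_comm, inter_comm Aᶜ, ← sdiff_eq, measure_inter_add_sdiff _ this]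

/-- A family of signed measures on a countably generated space whose evaluations are measurable
has measurable total variation. -/
lemma measurable_variation [MeasurableSpace.CountablyGenerated X] {U : α → SignedMeasure X}
    (hU : ∀ B, MeasurableSet B → Measurable fun a => U a B) :
    Measurable fun a => (U a).variation := by
  refine Measure.measurable_of_measurable_coe _ fun s hs => ?_
  set C := generateSetAlgebra (MeasurableSpace.countableGeneratingSet X)
  have hc : C.Countable := countable_generateSetAlgebra
    (MeasurableSpace.countable_countableGeneratingSet (α := X))
  have hgen : mX = MeasurableSpace.generateFrom C := by
    rw [generateFrom_generateSetAlgebra_eq, MeasurableSpace.generateFrom_countableGeneratingSet]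
  have hCm : ∀ A ∈ C, MeasurableSet A := fun A hA =>
    hgen ▸ MeasurableSpace.measurableSet_generateFrom hA
  simp_rw [fun a => variation_apply_eq_iSup (U a) isSetAlgebra_generateSetAlgebra hgen hs]
  exact Measurable.biSup _ hc fun A hA =>
    (hU _ ((hCm A hA).inter hs)).enorm.add (hU _ ((hCm A hA).compl.inter hs)).enorm

/-- A measurable family of finite measures is an s-finite kernel. -/
lemma isSFiniteKernel_of_isFiniteMeasure (κ : Kernel α X) (h : ∀ a, IsFiniteMeasure (κ a)) :
    IsSFiniteKernel κ := by
  classical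
  -- The masses are finite but need not be bounded in `a`; slicing by their integer part gives
  -- finite kernels.
  let c : ℕ → Set α := fun n => {a | ⌊(κ a univ).toNNReal⌋₊ = n}
  have hc : ∀ n, MeasurableSet (c n) := fun n =>
    (Nat.measurable_floor.comp (κ.measurable_coe .univ).ennreal_toNNReal) (measurableSet_singleton n)
  let κ' : ℕ → Kernel α X := fun n => Kernel.piecewise (hc n) κ 0
  refine ⟨κ', fun n => ⟨⟨n + 1, by finiteness, fun a => ?_⟩⟩, ?_⟩
  · by_cases ha : a ∈ c n
    · have : κ' n a = κ a := by simp [κ', Kernel.piecewise_apply, ha]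
      rw [this]
      have h1 := (Nat.lt_floor_add_one (κ a univ).toNNReal).le
      rw [show ⌊(κ a univ).toNNReal⌋₊ = n from ha] at h1
      rw [← ENNReal.coe_toNNReal (measure_ne_top (κ a) univ)]
      exact_mod_cast h1
    · simp [κ', Kernel.piecewise_apply, ha]
  · ext a s hs
    rw [Kernel.sum_apply, Measure.sum_apply _ hs, tsum_eq_single ⌊(κ a univ).toNNReal⌋₊]
    · simp [κ', Kernel.piecewise_apply, c]
    · intro n hn
      have : a ∉ c n := fun h => hn h.symm
      simp [κ', Kernel.piecewise_apply, this]

lemma measurable_posPart [MeasurableSpace.CountablyGenerated X] {U : α → SignedMeasure X}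
    (hU : ∀ B, MeasurableSet B → Measurable fun a => U a B) :
    Measurable fun a => (U a).toJordanDecomposition.posPart := by
  refine Measure.measurable_of_measurable_coe _ fun s hs => ?_
  -- This is `U⁺ = (|U| + U) / 2`, which reduces the claim to the total variation.
  have h : ∀ a, (U a).toJordanDecomposition.posPart s
      = ENNReal.ofReal ((((U a).variation s).toReal + U a s) / 2) := fun a => by
    rw [← (U a).totalVariation_eq_variation, (U a).apply_eq_posPart_real_sub_negPart_real hs,
      SignedMeasure.totalVariation, Measure.add_apply,
      ENNReal.toReal_add (measure_ne_top _ _) (measure_ne_top _ _)]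
    simp only [measureReal_def]
    rw [add_add_sub_cancel, add_self_div_two, ENNReal.ofReal_toReal (measure_ne_top _ _)]
  simp_rw [h]
  exact ((((Measure.measurable_coe hs).comp (measurable_variation hU)).ennreal_toReal.add
    (hU s hs)).div_const 2).ennreal_ofReal

lemma measurable_negPart [MeasurableSpace.CountablyGenerated X] {U : α → SignedMeasure X}
    (hU : ∀ B, MeasurableSet B → Measurable fun a => U a B) :
    Measurable fun a => (U a).toJordanDecomposition.negPart := by
  have h : ∀ a, (U a).toJordanDecomposition.negPart = (-U a).toJordanDecomposition.posPart :=
    fun a => by rw [SignedMeasure.toJordanDecomposition_neg, JordanDecomposition.neg_posPart]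
  simp_rw [h]
  exact measurable_posPart fun B hB => (hU B hB).neg

lemma integral_toSignedMeasure_sub {P N : Measure X} [IsFiniteMeasure P] [IsFiniteMeasure N]
    {h : X → ℝ} (hP : Integrable h P) (hN : Integrable h N) :
    ∫ᵛ x, h x ∂<•(P.toSignedMeasure - N.toSignedMeasure) = ∫ x, h x ∂P - ∫ x, h x ∂N := by
  rw [VectorMeasure.integral_sub_vectorMeasure, VectorMeasure.integral_toSignedMeasure,
    VectorMeasure.integral_toSignedMeasure]
  · simpa [VectorMeasure.Integrable, Measure.variation_toSignedMeasure] using hP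
  · simpa [VectorMeasure.Integrable, Measure.variation_toSignedMeasure] using hN

lemma integral_eq_posPart_sub_negPart (U : SignedMeasure X) {h : X → ℝ}
    (hh : Integrable h U.variation) :
    ∫ᵛ x, h x ∂<•U = ∫ x, h x ∂U.toJordanDecomposition.posPart
      - ∫ x, h x ∂U.toJordanDecomposition.negPart := by
  rw [← U.totalVariation_eq_variation, SignedMeasure.totalVariation,
    integrable_add_measure] at hh
  rw [← integral_toSignedMeasure_sub hh.1 hh.2]
  congr 1
  exact U.toSignedMeasure_toJordanDecomposition.symm

lemma measurable_coe_sign : Measurable fun r : ℝ => ((SignType.sign r : SignType) : ℝ) := by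
  have : (fun r : ℝ => ((SignType.sign r : SignType) : ℝ))
      = fun r => if 0 < r then 1 else if r < 0 then -1 else 0 := by
    ext r; rw [sign_apply]; split_ifs <;> simp
  rw [this]
  exact Measurable.ite measurableSet_Ioi measurable_const
    (Measurable.ite measurableSet_Iio measurable_const measurable_const)

/-- Both sides have the same norm `|h u|`; measurability is exchanged between `|u| h` and `h u` by
multiplying with the sign of `u`. -/
lemma integrable_withDensity_enorm_iff {l : Measure X} {u h : X → ℝ}
    (hu : AEStronglyMeasurable u l) :
    Integrable h (l.withDensity fun x => ‖u x‖ₑ) ↔ Integrable (fun x => h x * u x) l := by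
  rw [integrable_withDensity_iff_integrable_smul₀' hu.enorm (by simp)]
  have e : ∀ x, ‖‖u x‖ₑ.toReal • h x‖ = ‖h x * u x‖ := fun x => by
    simp [mul_comm]
  constructor
  · intro H
    refine (integrable_norm_iff ?_).1 ((H.norm).congr (.of_forall e))
    have : (fun x => h x * u x)
        = fun x => SignType.sign (u x) * (‖u x‖ₑ.toReal • h x) := by
      ext x
      rw [toReal_enorm, Real.norm_eq_abs, smul_eq_mul, ← mul_assoc, sign_mul_abs, mul_comm]
    rw [this]
    exact (measurable_coe_sign.comp_aemeasurable hu.aemeasurable).aestronglyMeasurable.mul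
      H.aestronglyMeasurable
  · intro H
    refine (integrable_norm_iff ?_).1 ((H.norm).congr (.of_forall fun x => (e x).symm))
    have : (fun x => ‖u x‖ₑ.toReal • h x)
        = fun x => SignType.sign (u x) * (h x * u x) := by
      ext x
      rw [toReal_enorm, Real.norm_eq_abs, smul_eq_mul, mul_comm (h x), ← mul_assoc, sign_mul_self]
    rw [this]
    exact (measurable_coe_sign.comp_aemeasurable hu.aemeasurable).aestronglyMeasurable.mul
      H.aestronglyMeasurable

/-- Integrability of `h` is not required: it fails on both sides at once, and both integrals then
have the default value `0`. -/
lemma integral_withDensityᵥ {l : Measure X} {u h : X → ℝ} (hu : Integrable u l) :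
    ∫ᵛ x, h x ∂<•(l.withDensityᵥ u) = ∫ x, h x * u x ∂l := by
  have hv := Measure.variation_withDensityᵥ hu
  by_cases hh : Integrable (fun x => h x * u x) l
  · have hh' : Integrable h (l.withDensity fun x => ‖u x‖ₑ) :=
      (integrable_withDensity_enorm_iff hu.aestronglyMeasurable).2 hh
    have hn : AEMeasurable (fun x => ENNReal.ofReal (-u x)) l :=
      hu.aestronglyMeasurable.aemeasurable.neg.ennreal_ofReal
    have := isFiniteMeasure_withDensity_ofReal hu.2
    have := isFiniteMeasure_withDensity_ofReal hu.neg.2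
    have hP : Integrable h (l.withDensity fun x => ENNReal.ofReal (u x)) :=
      hh'.mono_measure (withDensity_mono (.of_forall fun x => by
        beta_reduce; rw [← ofReal_norm]; exact ENNReal.ofReal_le_ofReal (le_abs_self _)))
    have hN : Integrable h (l.withDensity fun x => ENNReal.ofReal (-u x)) :=
      hh'.mono_measure (withDensity_mono (.of_forall fun x => by
        beta_reduce; rw [← ofReal_norm]; exact ENNReal.ofReal_le_ofReal (neg_le_abs _)))
    rw [withDensityᵥ_eq_withDensity_pos_part_sub_withDensity_neg_part hu]
    refine (integral_toSignedMeasure_sub hP hN).trans ?_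
    rw [integral_withDensity_eq_integral_toReal_smul₀
        hu.aestronglyMeasurable.aemeasurable.ennreal_ofReal (by simp),
      integral_withDensity_eq_integral_toReal_smul₀
        hn (by simp), ← integral_sub]
    · congr 1 with x
      simp only [ENNReal.toReal_ofReal', smul_eq_mul]
      rw [← sub_mul, max_zero_sub_max_neg_zero_eq_self, mul_comm]
    · exact (integrable_withDensity_iff_integrable_smul₀'
        hu.aestronglyMeasurable.aemeasurable.ennreal_ofReal (by simp)).1 hP
    · exact (integrable_withDensity_iff_integrable_smul₀'
        hn (by simp)).1 hN
  · rw [integral_undef hh, VectorMeasure.integral_undef]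
    rwa [VectorMeasure.Integrable, hv, integrable_withDensity_enorm_iff hu.aestronglyMeasurable]

lemma measurable_integral_signedMeasure [MeasurableSpace.CountablyGenerated X]
    {U : α → SignedMeasure X} (hU : ∀ B, MeasurableSet B → Measurable fun a => U a B)
    {h : α → X → ℝ} (hh : Measurable (uncurry h)) :
    Measurable fun a => ∫ᵛ x, h a x ∂<•(U a) := by
  let κ : Kernel α X := ⟨fun a => (U a).variation, measurable_variation hU⟩
  let κP : Kernel α X := ⟨fun a => (U a).toJordanDecomposition.posPart, measurable_posPart hU⟩
  let κN : Kernel α X := ⟨fun a => (U a).toJordanDecomposition.negPart, measurable_negPart hU⟩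
  have : IsSFiniteKernel κ := isSFiniteKernel_of_isFiniteMeasure κ fun a =>
    isFiniteMeasure_variation (U a)
  have : IsSFiniteKernel κP := isSFiniteKernel_of_isFiniteMeasure κP fun a =>
    (U a).toJordanDecomposition.posPart_finite
  have : IsSFiniteKernel κN := isSFiniteKernel_of_isFiniteMeasure κN fun a =>
    (U a).toJordanDecomposition.negPart_finite
  have hs : MeasurableSet {a | Integrable (h a) (κ a)} :=
    measurableSet_kernel_integrable hh.stronglyMeasurable
  -- The indicator accounts for the default value `0` at parameters where `h a` is not integrable.
  have e : (fun a => ∫ᵛ x, h a x ∂<•(U a)) = {a | Integrable (h a) (κ a)}.indicator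
      fun a => ∫ x, h a x ∂κP a - ∫ x, h a x ∂κN a := by
    ext a
    by_cases ha : Integrable (h a) (κ a)
    · rw [indicator_of_mem (by exact ha)]
      exact integral_eq_posPart_sub_negPart (U a) ha
    · rw [indicator_of_notMem (by exact ha)]
      exact VectorMeasure.integral_undef ha
  rw [e]
  exact ((hh.stronglyMeasurable.integral_kernel_prod_right (κ := κP)).measurable.sub
    (hh.stronglyMeasurable.integral_kernel_prod_right (κ := κN)).measurable).indicator hs

lemma measurable_lintegral_variation [MeasurableSpace.CountablyGenerated X]
    {U : α → SignedMeasure X} (hU : ∀ B, MeasurableSet B → Measurable fun a => U a B)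
    {h : α → X → ℝ≥0∞} (hh : Measurable (uncurry h)) :
    Measurable fun a => ∫⁻ x, h a x ∂(U a).variation := by
  let κ : Kernel α X := ⟨fun a => (U a).variation, measurable_variation hU⟩
  have : IsSFiniteKernel κ := isSFiniteKernel_of_isFiniteMeasure κ fun a =>
    isFiniteMeasure_variation (U a)
  exact Measurable.lintegral_kernel_prod_right (κ := κ) hh

end SignedMeasure

/-! ### From weak derivatives in time to increments between two times. -/

section WeakDerivative

open Filter Topology

/-- The smooth step rising from `0` at `c` to `1` at `c + ε`. -/
def smoothStep (c ε t : ℝ) : ℝ := Real.smoothTransition ((t - c) / ε)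

lemma contDiff_smoothStep (c ε : ℝ) : ContDiff ℝ 1 (smoothStep c ε) :=
  Real.smoothTransition.contDiff.comp ((contDiff_id.sub contDiff_const).div_const ε)

lemma smoothStep_eq_zero {c ε t : ℝ} (hε : 0 < ε) (h : t ≤ c) : smoothStep c ε t = 0 :=
  Real.smoothTransition.zero_of_nonpos (div_nonpos_of_nonpos_of_nonneg (by linarith) hε.le)

lemma smoothStep_eq_one {c ε t : ℝ} (hε : 0 < ε) (h : c + ε ≤ t) : smoothStep c ε t = 1 :=
  Real.smoothTransition.one_of_one_le ((one_le_div hε).2 (by linarith))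

lemma smoothStep_nonneg (c ε t : ℝ) : 0 ≤ smoothStep c ε t := Real.smoothTransition.nonneg _

lemma smoothStep_le_one (c ε t : ℝ) : smoothStep c ε t ≤ 1 := Real.smoothTransition.le_one _

lemma deriv_smoothStep_nonneg {c ε : ℝ} (hε : 0 < ε) (t : ℝ) : 0 ≤ deriv (smoothStep c ε) t := by
  refine Monotone.deriv_nonneg fun x y hxy => Real.smoothTransition.monotone ?_
  exact div_le_div_of_nonneg_right (by linarith) hε.le

lemma deriv_smoothStep_of_lt {c ε t : ℝ} (hε : 0 < ε) (h : t < c) :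
    deriv (smoothStep c ε) t = 0 := by
  have : smoothStep c ε =ᶠ[𝓝 t] fun _ => 0 := by
    filter_upwards [Iio_mem_nhds h] with x hx using smoothStep_eq_zero hε (le_of_lt hx)
  rw [this.deriv_eq, deriv_const]

lemma deriv_smoothStep_of_gt {c ε t : ℝ} (hε : 0 < ε) (h : c + ε < t) :
    deriv (smoothStep c ε) t = 0 := by
  have : smoothStep c ε =ᶠ[𝓝 t] fun _ => 1 := by
    filter_upwards [Ioi_mem_nhds h] with x hx using smoothStep_eq_one hε (le_of_lt hx)
  rw [this.deriv_eq, deriv_const]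

/-- The derivatives of smooth steps that rise near `x₀` are an approximate identity at `x₀`. -/
lemma tendsto_setIntegral_deriv_smoothStep {a b x₀ : ℝ} (hx₀ : x₀ ∈ Icc a b) {F : ℝ → ℝ}
    (hF : IntegrableOn F (Icc a b)) (hFx : ContinuousWithinAt F (Icc a b) x₀)
    {c : ℝ → ℝ} (hc : Tendsto c (𝓝[>] 0) (𝓝 x₀))
    (hca : ∀ᶠ ε in 𝓝[>] 0, a ≤ c ε) (hcb : ∀ᶠ ε in 𝓝[>] 0, c ε + ε ≤ b) :
    Tendsto (fun ε => ∫ t in Icc a b, deriv (smoothStep (c ε) ε) t * F t) (𝓝[>] 0)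
      (𝓝 (F x₀)) := by
  have hpos : ∀ᶠ ε : ℝ in 𝓝[>] 0, 0 < ε := self_mem_nhdsWithin
  refine tendsto_setIntegral_peak_smul_of_integrableOn_of_tendsto measurableSet_Icc
    measurableSet_Icc subset_rfl self_mem_nhdsWithin (by simp) ?_ ?_ ?_ ?_ hF hFx
  · filter_upwards [hpos] with ε hε t _ using deriv_smoothStep_nonneg hε t
  · intro u hu hxu
    obtain ⟨r, hr, hru⟩ := Metric.isOpen_iff.1 hu x₀ hxu
    have h1 : ∀ᶠ ε in 𝓝[>] 0, x₀ - r < c ε := hc.eventually_const_lt (by linarith)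
    have h2 : ∀ᶠ ε in 𝓝[>] 0, c ε + ε < x₀ + r := by
      have : Tendsto (fun ε => c ε + ε) (𝓝[>] 0) (𝓝 (x₀ + 0)) :=
        hc.add (tendsto_id.mono_left nhdsWithin_le_nhds)
      exact this.eventually_lt_const (by linarith)
    rw [Metric.tendstoUniformlyOn_iff]
    intro δ hδ
    filter_upwards [hpos, h1, h2] with ε hε h1 h2 t ht
    have : deriv (smoothStep (c ε) ε) t = 0 := by
      rcases lt_or_ge t (x₀ - r) with h | h
      · exact deriv_smoothStep_of_lt hε (h.trans h1)
      rcases lt_or_ge (x₀ + r) t with h' | h'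
      · exact deriv_smoothStep_of_gt hε (h2.trans h')
      by_cases e1 : t = x₀ - r
      · exact deriv_smoothStep_of_lt hε (e1 ▸ h1)
      by_cases e2 : t = x₀ + r
      · exact deriv_smoothStep_of_gt hε (e2 ▸ h2)
      refine absurd (hru ?_) ht.2
      rw [Real.ball_eq_Ioo]
      exact ⟨lt_of_le_of_ne h (Ne.symm e1), lt_of_le_of_ne h' e2⟩
    simpa [this] using hδ
  · refine tendsto_const_nhds.congr' ?_
    filter_upwards [hpos, hca, hcb] with ε hε h1 h2
    have hab : a ≤ b := hx₀.1.trans hx₀.2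
    rw [integral_Icc_eq_integral_Ioc, ← intervalIntegral.integral_of_le hab,
      intervalIntegral.integral_deriv_eq_sub
        (fun x _ => (contDiff_smoothStep (c ε) ε).differentiable one_ne_zero x)
        ((contDiff_smoothStep (c ε) ε).continuous_deriv le_rfl |>.intervalIntegrable _ _),
      smoothStep_eq_one hε h2, smoothStep_eq_zero hε h1, sub_zero]
  · exact .of_forall fun ε =>
      ((contDiff_smoothStep (c ε) ε).continuous_deriv le_rfl).aestronglyMeasurable

/-- A function with an integrable weak derivative satisfies the fundamental theorem of calculus
between two points of continuity. -/
lemma sub_eq_setIntegral_of_weakDeriv {T a b : ℝ} {F G : ℝ → ℝ} (ha : 0 ≤ a) (hab : a < b)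
    (hb : b ≤ T) (hF : IntegrableOn F (Icc 0 T)) (hG : IntegrableOn G (Icc 0 T))
    (hw : ∀ η : ℝ → ℝ, ContDiff ℝ 1 η → HasCompactSupport η → tsupport η ⊆ Ioo 0 T →
      (∫ t in Icc 0 T, deriv η t * F t) + ∫ t in Icc 0 T, η t * G t = 0)
    (hFa : ContinuousWithinAt F (Icc a b) a) (hFb : ContinuousWithinAt F (Icc a b) b) :
    F b - F a = ∫ t in Icc a b, G t := by
  have hsub : Icc a b ⊆ Icc 0 T := Icc_subset_Icc ha hb
  have hpos : ∀ᶠ ε : ℝ in 𝓝[>] 0, 0 < ε := self_mem_nhdsWithin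
  have hsmall : ∀ᶠ ε : ℝ in 𝓝[>] 0, 4 * ε < b - a :=
    (Tendsto.eventually_lt_const (by linarith) ((continuous_const.mul continuous_id).tendsto'
      0 0 (by simp))).filter_mono nhdsWithin_le_nhds
  have hlim0 : ∀ k x : ℝ, Tendsto (fun ε => x + k * ε) (𝓝[>] 0) (𝓝 x) := fun k x =>
    ((continuous_const.add (continuous_const.mul continuous_id)).tendsto' 0 x
      (by simp)).mono_left nhdsWithin_le_nhds
  -- One step rises on `[a + ε, a + 2ε]`, the other on `[b - 2ε, b - ε]`. Their difference tends to
  -- the indicator of `(a, b)` and is supported in `[a + ε, b - ε]`, so it is admissible even if `a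
  -- = 0` or `b = T`.
  have h1 := tendsto_setIntegral_deriv_smoothStep (left_mem_Icc.2 hab.le) (hF.mono_set hsub) hFa
    (hlim0 1 a) (by filter_upwards [hpos] with ε hε; linarith)
    (by filter_upwards [hpos, hsmall] with ε hε h; linarith)
  have h2 := tendsto_setIntegral_deriv_smoothStep (right_mem_Icc.2 hab.le) (hF.mono_set hsub) hFb
    (hlim0 (-2) b) (by filter_upwards [hpos, hsmall] with ε hε h; linarith)
    (by filter_upwards [hpos] with ε hε; linarith)
  have h3 : Tendsto (fun ε => ∫ t in Icc a b,
      (smoothStep (a + 1 * ε) ε t - smoothStep (b + -2 * ε) ε t) * G t) (𝓝[>] 0)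
      (𝓝 (∫ t in Icc a b, G t)) := by
    refine tendsto_integral_filter_of_dominated_convergence (fun t => |G t|)
      (.of_forall fun ε => ?_) (.of_forall fun ε => .of_forall fun t => ?_)
      (hG.mono_set hsub).abs ?_
    · exact (((contDiff_smoothStep _ _).continuous.sub
        (contDiff_smoothStep _ _).continuous).aestronglyMeasurable).mul
        (hG.mono_set hsub).aestronglyMeasurable
    · rw [norm_mul]
      refine mul_le_of_le_one_left (abs_nonneg _) (abs_le.2 ⟨?_, ?_⟩) <;>
      linarith [smoothStep_nonneg (a + 1 * ε) ε t, smoothStep_le_one (a + 1 * ε) ε t,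
        smoothStep_nonneg (b + -2 * ε) ε t, smoothStep_le_one (b + -2 * ε) ε t]
    · rw [← Measure.restrict_congr_set Ioo_ae_eq_Icc]
      filter_upwards [ae_restrict_mem measurableSet_Ioo] with t ht
      refine tendsto_const_nhds.congr' ?_
      filter_upwards [hpos, (hlim0 2 a).eventually_lt_const ht.1,
        (hlim0 (-2) b).eventually_const_lt ht.2] with ε hε e1 e2
      rw [smoothStep_eq_one hε (by linarith), smoothStep_eq_zero hε e2.le, sub_zero, one_mul]
  have h4 := (h1.sub h2).add h3
  refine sub_eq_zero.1 (?_ : F b - F a - ∫ t in Icc a b, G t = 0)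
  have h5 : F a - F b + ∫ t in Icc a b, G t = 0 := by
    refine tendsto_nhds_unique h4 (tendsto_const_nhds.congr' ?_)
    filter_upwards [hpos, hsmall] with ε hε hε'
    set p := smoothStep (a + 1 * ε) ε with hp
    set q := smoothStep (b + -2 * ε) ε with hq
    have hpd : ContDiff ℝ 1 p := contDiff_smoothStep _ _
    have hqd : ContDiff ℝ 1 q := contDiff_smoothStep _ _
    have hz : ∀ t, t ∉ Icc (a + ε) (b - ε) → p t - q t = 0 := fun t ht => by
      rcases lt_or_ge t (a + ε) with h | h
      · rw [hp, hq, smoothStep_eq_zero hε (by linarith), smoothStep_eq_zero hε (by linarith),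
          sub_zero]
      · have : b - ε < t := by by_contra h'; exact ht ⟨h, not_lt.1 h'⟩
        rw [hp, hq, smoothStep_eq_one hε (by linarith), smoothStep_eq_one hε (by linarith),
          sub_self]
    have hts : tsupport (fun t => p t - q t) ⊆ Icc (a + ε) (b - ε) :=
      closure_minimal (fun t ht => by by_contra h; exact ht (hz t h)) isClosed_Icc
    have := hw (fun t => p t - q t) (hpd.sub hqd)
      (isCompact_Icc.of_isClosed_subset (isClosed_tsupport _) hts)
      (hts.trans (Icc_subset_Ioo (by linarith) (by linarith)))
    have e1 : ∫ t in Icc 0 T, deriv (fun t => p t - q t) t * F t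
        = (∫ t in Icc a b, deriv p t * F t) - ∫ t in Icc a b, deriv q t * F t := by
      have hi : ∀ r : ℝ → ℝ, ContDiff ℝ 1 r → IntegrableOn (fun t => deriv r t * F t) (Icc a b) :=
        fun r hr => (hF.mono_set hsub).continuousOn_mul (hr.continuous_deriv le_rfl).continuousOn
          isCompact_Icc
      rw [← integral_sub (hi p hpd) (hi q hqd)]
      symm
      rw [← setIntegral_eq_of_subset_of_forall_sdiff_eq_zero measurableSet_Icc hsub
        (f := fun t => deriv p t * F t - deriv q t * F t)]
      · refine setIntegral_congr_fun measurableSet_Icc fun t _ => ?_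
        rw [deriv_fun_sub (hpd.differentiable one_ne_zero t) (hqd.differentiable one_ne_zero t)]
        ring
      · intro t ht
        rcases lt_or_ge t a with h | h
        · rw [deriv_smoothStep_of_lt hε (by linarith), deriv_smoothStep_of_lt hε (by linarith)]
          ring
        · have : b < t := by by_contra h'; exact ht.2 ⟨h, not_lt.1 h'⟩
          rw [deriv_smoothStep_of_gt hε (by linarith), deriv_smoothStep_of_gt hε (by linarith)]
          ring
    have e2 : ∫ t in Icc 0 T, (p t - q t) * G t = ∫ t in Icc a b, (p t - q t) * G t := by
      refine setIntegral_eq_of_subset_of_forall_sdiff_eq_zero measurableSet_Icc hsub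
        fun t ht => ?_
      rw [hz t fun h => ht.2 ⟨by linarith [h.1], by linarith [h.2]⟩, zero_mul]
    rw [← e1, ← e2, this]
  linarith

end WeakDerivative

/-! ### Cutoffs and Huber functions. -/

section TestFunctions

open Filter Topology

/-- Compactly supported truncations of a Lipschitz function, with uniformly bounded slopes. -/
lemma exists_cutoff {φ : ℝ → ℝ} (hφ : ContDiff ℝ 1 φ) {L : ℝ} (hL : ∀ v, |deriv φ v| ≤ L) :
    ∃ (ψ : ℕ → ℝ → ℝ) (C : ℝ), (∀ n, ContDiff ℝ 1 (ψ n)) ∧ (∀ n, HasCompactSupport (ψ n)) ∧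
      (∀ n v, |deriv (ψ n) v| ≤ C) ∧ (∀ n v, |ψ n v| ≤ |φ v|) ∧
      (∀ n v, 0 ≤ φ v → 0 ≤ ψ n v) ∧ (∀ v, ∀ᶠ n in atTop, ψ n =ᶠ[𝓝 v] φ) := by
  let χ : ContDiffBump (0 : ℝ) := ⟨1, 2, one_pos, one_lt_two⟩
  have hχ : ContDiff ℝ 1 χ := χ.contDiff
  obtain ⟨M, hM⟩ := (hχ.continuous_deriv le_rfl).bounded_above_of_compact_support
    χ.hasCompactSupport.deriv
  have hM0 : 0 ≤ M := (norm_nonneg _).trans (hM 0)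
  have hL0 : 0 ≤ L := (abs_nonneg _).trans (hL 0)
  have hφb : ∀ v, |φ v| ≤ |φ 0| + L * |v| := fun v => by
    have := Convex.norm_image_sub_le_of_norm_deriv_le (f := φ) (C := L) (s := univ) (x := 0) (y := v)
      (fun x _ => hφ.differentiable one_ne_zero x) (fun x _ => hL x) convex_univ trivial trivial
    rw [Real.norm_eq_abs, Real.norm_eq_abs, sub_zero] at this
    linarith [abs_sub_abs_le_abs_sub (φ v) (φ 0)]
  have hdχ : ∀ x, 2 < |x| → deriv χ x = 0 := fun x hx => by
    have : (χ : ℝ → ℝ) =ᶠ[𝓝 x] fun _ => 0 := by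
      filter_upwards [continuous_abs.continuousAt.eventually_const_lt hx] with y hy
      exact χ.zero_of_le_dist (by simpa using (le_of_lt hy : (2 : ℝ) ≤ |y|))
    rw [this.deriv_eq, deriv_const]
  have hn : ∀ n : ℕ, (0 : ℝ) < n + 1 := fun n => by positivity
  have hd : ∀ (n : ℕ) v, HasDerivAt (fun v : ℝ => χ (v / (n + 1)))
      (deriv χ (v / (n + 1)) * (1 / (n + 1))) v := fun n v =>
    (hχ.differentiable one_ne_zero _).hasDerivAt.comp v ((hasDerivAt_id v).div_const _)
  -- The derivative of the cutoff lives on `|v| ≤ 2(n + 1)`, where `|φ| ≤ |φ 0| + 2L(n + 1)`; the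
  -- factor `1/(n + 1)` compensates this growth, so the slope bound is uniform in `n`.
  refine ⟨fun n v => χ (v / (n + 1)) * φ v, M * (|φ 0| + 2 * L) + L, fun n => ?_, fun n => ?_,
    fun n v => ?_, fun n v => ?_, fun n v hv => mul_nonneg χ.nonneg hv, fun v => ?_⟩
  · exact (hχ.comp (contDiff_id.div_const _)).mul hφ
  · refine HasCompactSupport.mul_right ?_
    refine HasCompactSupport.of_support_subset_isCompact
      (isCompact_Icc (a := -(2 * ((n : ℝ) + 1))) (b := 2 * (n + 1))) fun v hv => ?_
    by_contra h
    refine hv (χ.zero_of_le_dist ?_)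
    rw [Real.dist_0_eq_abs, abs_div, abs_of_pos (hn n)]
    refine (le_div_iff₀ (hn n)).2 (le_of_not_ge fun h' => h (abs_le.1 h'))
  · have e : deriv (fun v : ℝ => χ (v / (n + 1)) * φ v) v = _ :=
      ((hd n v).mul (hφ.differentiable one_ne_zero v).hasDerivAt).deriv
    rw [e]
    have h1 : |χ (v / (n + 1)) * deriv φ v| ≤ L := by
      rw [abs_mul, abs_of_nonneg χ.nonneg]
      exact (mul_le_of_le_one_left (abs_nonneg _) χ.le_one).trans (hL v)
    have h2 : |deriv χ (v / (n + 1)) * (1 / (n + 1)) * φ v| ≤ M * (|φ 0| + 2 * L) := by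
      rcases lt_or_ge 2 |v / ((n : ℝ) + 1)| with h | h
      · rw [hdχ _ h, zero_mul, zero_mul, abs_zero]; positivity
      · rw [abs_div, abs_of_pos (hn n), div_le_iff₀ (hn n)] at h
        rw [mul_assoc, abs_mul]
        refine mul_le_mul (hM _) ?_ (abs_nonneg _) hM0
        rw [abs_mul, abs_of_pos (by positivity), one_div, inv_mul_le_iff₀ (hn n)]
        have h3 : L * |v| ≤ L * (2 * (n + 1)) := by gcongr
        have h4 : |φ 0| ≤ (n + 1) * |φ 0| :=
          le_mul_of_one_le_left (abs_nonneg _) (by linarith [n.cast_nonneg (α := ℝ)])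
        linarith [hφb v]
    exact (abs_add_le _ _).trans (add_le_add h2 h1)
  · rw [abs_mul, abs_of_nonneg χ.nonneg]
    exact mul_le_of_le_one_left (abs_nonneg _) χ.le_one
  · filter_upwards [eventually_gt_atTop ⌈|v|⌉₊] with n hnv
    have : |v| < n + 1 := (Nat.le_ceil _).trans_lt (by exact_mod_cast hnv.trans (Nat.lt_succ_self n))
    filter_upwards [continuous_abs.continuousAt.eventually_lt_const this] with w hw
    have : χ (w / ((n : ℝ) + 1)) = 1 := by
      refine χ.one_of_mem_closedBall ?_
      rw [mem_closedBall_zero_iff, Real.norm_eq_abs, abs_div, abs_of_pos (hn n)]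
      exact ((div_le_one (hn n)).2 hw.le)
    rw [this, one_mul]

lemma hasDerivAt_sq_posPart_half (x : ℝ) :
    HasDerivAt (fun x : ℝ => (max x 0) ^ 2 / 2) (max x 0) x := by
  rcases lt_trichotomy x 0 with h | rfl | h
  · rw [max_eq_right h.le]
    refine (hasDerivAt_const x (0 : ℝ)).congr_of_eventuallyEq ?_
    filter_upwards [Iio_mem_nhds h] with y hy
    rw [max_eq_right (le_of_lt hy)]; norm_num
  · rw [max_self, hasDerivAt_iff_isLittleO_nhds_zero]
    have h1 : (fun h : ℝ => (max (0 + h) 0) ^ 2 / 2 - (max (0 : ℝ) 0) ^ 2 / 2 - h • (0 : ℝ))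
        =O[𝓝 0] fun h : ℝ => h ^ 2 := by
      refine Asymptotics.IsBigO.of_bound 1 (.of_forall fun h => ?_)
      simp only [zero_add, max_self, smul_zero, sub_zero, one_mul, Real.norm_eq_abs]
      have h0 : (0 : ℝ) ^ 2 / 2 = 0 := by norm_num
      rw [h0, sub_zero, abs_of_nonneg (by positivity), abs_of_nonneg (by positivity)]
      rcases le_total h 0 with h' | h'
      · rw [max_eq_right h']; nlinarith [sq_nonneg h]
      · rw [max_eq_left h']; nlinarith [sq_nonneg h]
    exact h1.trans_isLittleO (by simpa using Asymptotics.isLittleO_pow_pow (one_lt_two))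
  · rw [max_eq_left h.le]
    have h1 : HasDerivAt (fun x : ℝ => x ^ 2 / 2) x x := by
      simpa using (hasDerivAt_pow 2 x).div_const 2
    refine h1.congr_of_eventuallyEq ?_
    filter_upwards [Ioi_mem_nhds h] with y hy
    rw [max_eq_left (le_of_lt hy)]

/-- The Huber function: `v² / 2` for `|v| ≤ R`, continued affinely. -/
def huber (R v : ℝ) : ℝ := v ^ 2 / 2 - (max (v - R) 0) ^ 2 / 2 - (max (-v - R) 0) ^ 2 / 2

lemma hasDerivAt_huber {R : ℝ} (hR : 0 ≤ R) (v : ℝ) :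
    HasDerivAt (huber R) (max (-R) (min v R)) v := by
  have h0 : HasDerivAt (fun x : ℝ => x ^ 2 / 2) v v := by
    simpa using (hasDerivAt_pow 2 v).div_const 2
  have h1 := (hasDerivAt_sq_posPart_half (v - R)).comp v ((hasDerivAt_id v).sub_const R)
  have h2 := (hasDerivAt_sq_posPart_half (-v - R)).comp v ((hasDerivAt_id v).neg.sub_const R)
  have e : max (-R) (min v R) = v - max (v - R) 0 * 1 - max (-v - R) 0 * -1 := by grind
  rw [e]
  exact (h0.sub h1).sub h2

lemma deriv_huber {R : ℝ} (hR : 0 ≤ R) : deriv (huber R) = fun v => max (-R) (min v R) :=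
  funext fun v => (hasDerivAt_huber hR v).deriv

lemma contDiff_huber {R : ℝ} (hR : 0 ≤ R) : ContDiff ℝ 1 (huber R) := by
  rw [contDiff_one_iff_deriv, deriv_huber hR]
  exact ⟨fun v => (hasDerivAt_huber hR v).differentiableAt, by fun_prop⟩

lemma abs_deriv_huber_le {R : ℝ} (hR : 0 ≤ R) (v : ℝ) : |deriv (huber R) v| ≤ R := by
  rw [deriv_huber hR, abs_le]; grind

lemma huber_nonneg {R : ℝ} (hR : 0 ≤ R) (v : ℝ) : 0 ≤ huber R v := by
  rw [huber]
  rcases le_total (v - R) 0 with h | h <;> rcases le_total (-v - R) 0 with h' | h' <;>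
    simp only [h, h', max_eq_left, max_eq_right] <;> nlinarith

lemma huber_le {R : ℝ} (v : ℝ) : huber R v ≤ v ^ 2 / 2 := by
  rw [huber]; nlinarith [sq_nonneg (max (v - R) 0), sq_nonneg (max (-v - R) 0)]

lemma huber_eq {R v : ℝ} (h : |v| ≤ R) : huber R v = v ^ 2 / 2 := by
  obtain ⟨h1, h2⟩ := abs_le.1 h
  rw [huber, max_eq_right (by linarith), max_eq_right (by linarith)]; ring

/-- This lets `huber 1` replace `|v|`, which is not `C¹`, in first-moment estimates. -/
lemma abs_le_huber_one_add (v : ℝ) : |v| ≤ huber 1 v + 1 / 2 := by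
  rw [huber]
  rcases le_total (v - 1) 0 with h | h <;> rcases le_total (-v - 1) 0 with h' | h' <;>
    simp only [h, h', max_eq_left, max_eq_right] <;> rcases abs_cases v with ⟨e, _⟩ | ⟨e, _⟩ <;>
    rw [e] <;> nlinarith [sq_nonneg (v - 1), sq_nonneg (v + 1)]

lemma deriv_huber_eq {R v : ℝ} (h : |v| ≤ R) : deriv (huber R) v = v := by
  obtain ⟨h1, h2⟩ := abs_le.1 h
  rw [deriv_huber ((abs_nonneg v).trans h)]; grind

/-- Clamping to `[-R, R]` is 1-Lipschitz. The bound does not involve `R` and is the domination used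
as `R → ∞`. -/
lemma abs_deriv_huber_sub_le {R : ℝ} (hR : 0 ≤ R) (v w : ℝ) :
    |deriv (huber R) v - deriv (huber R) w| ≤ |v - w| := by
  rw [deriv_huber hR]
  rcases abs_cases (v - w) with ⟨e, _⟩ | ⟨e, _⟩ <;> rw [e, abs_le] <;> constructor <;> grind

/-- Clamping is monotone. The sign makes the truncated dissipations nonnegative, so that Fatou's
lemma applies to them. -/
lemma deriv_huber_sub_mul_nonneg {R : ℝ} (hR : 0 ≤ R) (v w : ℝ) :
    0 ≤ (deriv (huber R) v - deriv (huber R) w) * (v - w) := by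
  rw [deriv_huber hR]
  rcases le_total v w with h | h
  · exact mul_nonneg_of_nonpos_of_nonpos (by grind) (by linarith)
  · exact mul_nonneg (by grind) (by linarith)

end TestFunctions

/-! ### Pointwise inequalities for the action density. -/

section Alpha

lemma alpha_of_toReal {s : ℝ≥0∞} {u : ℝ} (hs : s ≠ ∞) (hs0 : s ≠ 0) :
    alpha s u = ENNReal.ofReal (u ^ 2 / s.toReal) := by
  have hpos := ENNReal.toReal_pos hs0 hs
  rw [alpha]
  split_ifs with h
  · simp [h]
  · rw [ENNReal.ofReal_div_of_pos hpos, ENNReal.ofReal_toReal hs]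

lemma alpha_zero_right (s : ℝ≥0∞) : alpha s 0 = 0 := by simp [alpha]

lemma alpha_zero_left {u : ℝ} (hu : u ≠ 0) : alpha 0 u = ∞ := by simp [alpha, hu]

lemma measurable_alpha : Measurable fun p : ℝ≥0∞ × ℝ => alpha p.1 p.2 := by
  unfold alpha
  refine Measurable.ite (measurableSet_eq_fun measurable_snd measurable_const) measurable_const
    (Measurable.ite (measurableSet_eq_fun measurable_fst measurable_const) measurable_const ?_)
  exact ((measurable_snd.pow_const 2).ennreal_ofReal).div measurable_fst

/-- Young's inequality for the pairing weighted by `s`. -/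
lemma enorm_mul_le_alpha {s : ℝ≥0∞} (hs : s ≠ ∞) (u h : ℝ) {δ : ℝ} (hδ : 0 < δ) :
    ‖h * u‖ₑ ≤ ENNReal.ofReal δ * (s * ENNReal.ofReal (h ^ 2))
      + ENNReal.ofReal (1 / (4 * δ)) * alpha s u := by
  by_cases hu : u = 0
  · simp [hu]
  by_cases hs0 : s = 0
  · rw [hs0, alpha_zero_left hu, ENNReal.mul_top (by simpa using hδ)]; simp
  have hpos := ENNReal.toReal_pos hs0 hs
  have h1 : s * ENNReal.ofReal (h ^ 2) = ENNReal.ofReal (s.toReal * h ^ 2) := by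
    rw [ENNReal.ofReal_mul hpos.le, ENNReal.ofReal_toReal hs]
  rw [h1, alpha_of_toReal hs hs0, ← ENNReal.ofReal_mul hδ.le, ← ENNReal.ofReal_mul (by positivity),
    ← ENNReal.ofReal_add (by positivity) (by positivity), ← ofReal_norm, Real.norm_eq_abs]
  refine ENNReal.ofReal_le_ofReal ?_
  set r := s.toReal
  have h2 : δ * (r * h ^ 2) + 1 / (4 * δ) * (u ^ 2 / r)
      = ((2 * δ * r * |h| - |u|) ^ 2) / (4 * δ * r) + |h| * |u| := by
    rw [← sq_abs h, ← sq_abs u]; field_simp; ring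
  rw [h2, abs_mul]
  have : 0 ≤ ((2 * δ * r * |h| - |u|) ^ 2) / (4 * δ * r) := by positivity
  linarith

/-- Completing the square. -/
lemma alpha_add_eq {s : ℝ≥0∞} (hs : s ≠ ∞) (u g : ℝ) :
    alpha s u + s * ENNReal.ofReal (g ^ 2) + ENNReal.ofReal (2 * -(g * u))
      = alpha s (u - s.toReal * g) + ENNReal.ofReal (2 * (g * u)) := by
  -- The positive and negative parts of the cross term stand on opposite sides, which avoids
  -- subtraction in `ℝ≥0∞`. At `s = 0` the two sides are both `0` or both `∞`.
  by_cases hs0 : s = 0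
  · subst hs0
    by_cases hu : u = 0
    · simp [hu]
    · simp [alpha_zero_left hu]
  have hpos := ENNReal.toReal_pos hs0 hs
  have h1 : s * ENNReal.ofReal (g ^ 2) = ENNReal.ofReal (s.toReal * g ^ 2) := by
    rw [ENNReal.ofReal_mul hpos.le, ENNReal.ofReal_toReal hs]
  rw [h1, alpha_of_toReal hs hs0, alpha_of_toReal hs hs0]
  set r := s.toReal
  have h2 : (u - r * g) ^ 2 / r = u ^ 2 / r + r * g ^ 2 - 2 * (g * u) := by field_simp; ring
  have h3 : 0 ≤ (u - r * g) ^ 2 / r := by positivity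
  rw [← ENNReal.ofReal_add (by positivity) (by positivity)]
  rcases le_total 0 (g * u) with h | h
  · rw [ENNReal.ofReal_of_nonpos (show 2 * -(g * u) ≤ 0 by linarith), add_zero,
      ← ENNReal.ofReal_add h3 (by positivity)]
    congr 1; linarith
  · rw [ENNReal.ofReal_of_nonpos (show 2 * (g * u) ≤ 0 by linarith), add_zero,
      ← ENNReal.ofReal_add (by positivity) (by linarith)]
    congr 1; linarith

/-- Split `u = (u - s g) + s g` and use `(x + y)² ≤ 2x² + 2y²`. It shows that an infinite action
forces an infinite excess when the `g`-term is finite. -/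
lemma alpha_le_two_mul {s : ℝ≥0∞} (hs : s ≠ ∞) (u g : ℝ) :
    alpha s u ≤ 2 * alpha s (u - s.toReal * g) + 2 * (s * ENNReal.ofReal (g ^ 2)) := by
  by_cases hs0 : s = 0
  · subst hs0
    by_cases hu : u = 0
    · simp [hu, alpha_zero_right]
    · simp [alpha_zero_left hu]
  have hpos := ENNReal.toReal_pos hs0 hs
  have h1 : s * ENNReal.ofReal (g ^ 2) = ENNReal.ofReal (s.toReal * g ^ 2) := by
    rw [ENNReal.ofReal_mul hpos.le, ENNReal.ofReal_toReal hs]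
  rw [h1, alpha_of_toReal hs hs0, alpha_of_toReal hs hs0]
  set r := s.toReal
  have e2 : (2 : ℝ≥0∞) = ENNReal.ofReal 2 := by simp
  rw [e2, ← ENNReal.ofReal_mul (by norm_num), ← ENNReal.ofReal_mul (by norm_num),
    ← ENNReal.ofReal_add (by positivity) (by positivity)]
  refine ENNReal.ofReal_le_ofReal ?_
  have h2 : 2 * ((u - r * g) ^ 2 / r) + 2 * (r * g ^ 2)
      = u ^ 2 / r + (u - 2 * r * g) ^ 2 / r := by field_simp; ring
  rw [h2]
  have : 0 ≤ (u - 2 * r * g) ^ 2 / r := by positivity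
  linarith

lemma alpha_mul_self_le {s : ℝ≥0∞} (hs : s ≠ ∞) (g : ℝ) :
    alpha s (s.toReal * g) ≤ s * ENNReal.ofReal (g ^ 2) := by
  by_cases hs0 : s = 0
  · subst hs0; simp [alpha_zero_right]
  have hpos := ENNReal.toReal_pos hs0 hs
  rw [alpha_of_toReal hs hs0]
  nth_rw 3 [← ENNReal.ofReal_toReal hs]
  rw [← ENNReal.ofReal_mul hpos.le]
  refine ENNReal.ofReal_le_ofReal (le_of_eq ?_)
  field_simp

end Alpha

/-! ### The action relative to a reference velocity. -/

section Action

variable {X : Type*} [MeasurableSpace X]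

lemma absolutelyContinuous_add_variation (μ : Measure X) (U : SignedMeasure X) :
    μ ≪ μ + U.variation := Measure.absolutelyContinuous_of_le (Measure.le_add_right le_rfl)

lemma withDensityᵥ_rnDeriv_add_variation (μ : Measure X) [IsFiniteMeasure μ]
    (U : SignedMeasure X) :
    (μ + U.variation).withDensityᵥ (U.rnDeriv (μ + U.variation)) = U := by
  refine U.withDensityᵥ_rnDeriv_eq _ ?_
  refine VectorMeasure.AbsolutelyContinuous.mk fun s hs h => ?_
  rw [Measure.toENNRealVectorMeasure_apply_measurable hs, Measure.add_apply, add_eq_zero] at h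
  exact enorm_eq_zero.1 (le_antisymm ((U.enorm_measure_le_variation s).trans h.2.le) bot_le)

lemma variation_eq_withDensity_rnDeriv (μ : Measure X) [IsFiniteMeasure μ]
    (U : SignedMeasure X) :
    U.variation
      = (μ + U.variation).withDensity fun x => ‖U.rnDeriv (μ + U.variation) x‖ₑ := by
  rw [← Measure.variation_withDensityᵥ (SignedMeasure.integrable_rnDeriv _ _),
    withDensityᵥ_rnDeriv_add_variation]

lemma rnDeriv_add_variation_ne_top (μ : Measure X) [IsFiniteMeasure μ] (U : SignedMeasure X) :
    ∀ᵐ x ∂(μ + U.variation), μ.rnDeriv (μ + U.variation) x ≠ ∞ := by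
  filter_upwards [μ.rnDeriv_lt_top (μ + U.variation)] with x hx using hx.ne

lemma lintegral_eq_lintegral_rnDeriv_mul (μ : Measure X) [IsFiniteMeasure μ]
    (U : SignedMeasure X) {F : X → ℝ≥0∞} (hF : Measurable F) :
    ∫⁻ x, F x ∂μ = ∫⁻ x, μ.rnDeriv (μ + U.variation) x * F x ∂(μ + U.variation) :=
  (lintegral_rnDeriv_mul (absolutelyContinuous_add_variation μ U) hF.aemeasurable).symm

lemma lintegral_variation_eq (μ : Measure X) [IsFiniteMeasure μ]
    (U : SignedMeasure X) {F : X → ℝ≥0∞} (hF : Measurable F) :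
    ∫⁻ x, F x ∂U.variation
      = ∫⁻ x, ‖U.rnDeriv (μ + U.variation) x‖ₑ * F x ∂(μ + U.variation) := by
  conv_lhs => rw [variation_eq_withDensity_rnDeriv μ U]
  rw [lintegral_withDensity_eq_lintegral_mul _ (SignedMeasure.measurable_rnDeriv _ _).enorm hF]
  rfl

/-- The weighted action of `U` relative to `μ`, with `s • g` subtracted from the flux density. -/
def relAction (w g : X → ℝ) (μ : Measure X) (U : SignedMeasure X) : ℝ≥0∞ :=
  ∫⁻ x, alpha (μ.rnDeriv (μ + U.variation) x)
      (U.rnDeriv (μ + U.variation) x - (μ.rnDeriv (μ + U.variation) x).toReal * g x)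
      * ENNReal.ofReal (w x) ∂(μ + U.variation)

variable {w g : X → ℝ} (μ : Measure X) [IsFiniteMeasure μ] (U : SignedMeasure X)

/-- Young's inequality integrated against `μ + |U|`. The parameter `δ` stays free so that the first
term can later be absorbed. -/
lemma lintegral_variation_le_relAction (hw : Measurable w) {h : X → ℝ} (hh : Measurable h)
    {δ : ℝ} (hδ : 0 < δ) :
    ∫⁻ x, ENNReal.ofReal (w x) * ‖h x‖ₑ ∂U.variation
      ≤ ENNReal.ofReal δ * ∫⁻ x, ENNReal.ofReal (w x) * ENNReal.ofReal (h x ^ 2) ∂μ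
        + ENNReal.ofReal (1 / (4 * δ)) * relAction w 0 μ U := by
  have m1 : Measurable fun x => ENNReal.ofReal (w x) * ‖h x‖ₑ := hw.ennreal_ofReal.mul hh.enorm
  have m2 : Measurable fun x => ENNReal.ofReal (w x) * ENNReal.ofReal (h x ^ 2) :=
    hw.ennreal_ofReal.mul (hh.pow_const 2).ennreal_ofReal
  rw [lintegral_variation_eq μ U m1, lintegral_eq_lintegral_rnDeriv_mul μ U m2,
    relAction, ← lintegral_const_mul' _ _ (by finiteness),
    ← lintegral_const_mul' _ _ (by finiteness), ← lintegral_add_left]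
  · refine lintegral_mono_ae ?_
    filter_upwards [rnDeriv_add_variation_ne_top μ U] with x hx
    have := enorm_mul_le_alpha hx (U.rnDeriv (μ + U.variation) x) (h x) hδ
    simp only [Pi.zero_apply, mul_zero, sub_zero]
    calc _ = ENNReal.ofReal (w x) * ‖h x * U.rnDeriv (μ + U.variation) x‖ₑ := by
          rw [enorm_mul]; ring
      _ ≤ ENNReal.ofReal (w x) * _ := mul_le_mul' le_rfl this
      _ = _ := by ring
  · exact measurable_const.mul ((Measure.measurable_rnDeriv _ _).mul m2)

/-- The density of `U - g μ` with respect to `μ + |U|` is `u - s g`, so Young's inequality bounds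
its pairing with `w h` by the relative action. A flux of small excess is thus close to `g μ` as seen
by test functions. -/
lemma enorm_integral_sub_le_relAction (hw : Measurable w) (hw0 : ∀ x, 0 ≤ w x)
    {h : X → ℝ} (hh : Measurable h) (hU : Integrable (fun x => w x * h x) U.variation)
    (hμ : Integrable (fun x => w x * h x * g x) μ) {δ : ℝ} (hδ : 0 < δ) :
    ‖(∫ᵛ x, w x * h x ∂<•U) - ∫ x, w x * h x * g x ∂μ‖ₑ
      ≤ ENNReal.ofReal δ * ∫⁻ x, ENNReal.ofReal (w x) * ENNReal.ofReal (h x ^ 2) ∂μ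
        + ENNReal.ofReal (1 / (4 * δ)) * relAction w g μ U := by
  set l := μ + U.variation with hl
  set u := U.rnDeriv l
  have hui : Integrable u l := SignedMeasure.integrable_rnDeriv _ _
  have e1 : ∫ᵛ x, w x * h x ∂<•U = ∫ x, w x * h x * u x ∂l := by
    conv_lhs => rw [← withDensityᵥ_rnDeriv_add_variation μ U]
    exact integral_withDensityᵥ hui
  have i1 : Integrable (fun x => w x * h x * u x) l := by
    rw [← integrable_withDensity_enorm_iff hui.aestronglyMeasurable]
    rwa [variation_eq_withDensity_rnDeriv μ U] at hU
  have hac := absolutelyContinuous_add_variation μ U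
  have e2 : ∫ x, w x * h x * g x ∂μ
      = ∫ x, (μ.rnDeriv l x).toReal • (w x * h x * g x) ∂l := (integral_rnDeriv_smul hac).symm
  have i2 : Integrable (fun x => (μ.rnDeriv l x).toReal • (w x * h x * g x)) l :=
    (integrable_rnDeriv_smul_iff hac).2 hμ
  rw [e1, e2, ← integral_sub i1 i2]
  refine (enorm_integral_le_lintegral_enorm _).trans ?_
  have m2 : Measurable fun x => ENNReal.ofReal (w x) * ENNReal.ofReal (h x ^ 2) :=
    hw.ennreal_ofReal.mul (hh.pow_const 2).ennreal_ofReal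
  rw [lintegral_eq_lintegral_rnDeriv_mul μ U m2,
    relAction, ← lintegral_const_mul' _ _ (by finiteness),
    ← lintegral_const_mul' _ _ (by finiteness), ← lintegral_add_left]
  · refine lintegral_mono_ae ?_
    filter_upwards [rnDeriv_add_variation_ne_top μ U] with x hx
    have := enorm_mul_le_alpha hx (u x - (μ.rnDeriv l x).toReal * g x) (h x) hδ
    have ew : ‖w x‖ₑ = ENNReal.ofReal (w x) := Real.enorm_of_nonneg (hw0 x)
    calc _ = ENNReal.ofReal (w x) * ‖h x * (u x - (μ.rnDeriv l x).toReal * g x)‖ₑ := by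
          rw [← ew, ← enorm_mul, smul_eq_mul]; congr 1; ring
      _ ≤ ENNReal.ofReal (w x) * _ := mul_le_mul' le_rfl this
      _ = _ := by ring
  · exact measurable_const.mul ((Measure.measurable_rnDeriv _ _).mul m2)

/-- Completing the square in the action. -/
lemma relAction_zero_add_eq (hw : Measurable w) (hw0 : ∀ x, 0 ≤ w x) (hg : Measurable g)
    (hD : ∫⁻ x, ENNReal.ofReal (w x) * ENNReal.ofReal (g x ^ 2) ∂μ ≠ ∞) :
    relAction w 0 μ U + ∫⁻ x, ENNReal.ofReal (w x) * ENNReal.ofReal (g x ^ 2) ∂μ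
        + ENNReal.ofReal (2 * -∫ᵛ x, w x * g x ∂<•U)
      = relAction w g μ U + ENNReal.ofReal (2 * ∫ᵛ x, w x * g x ∂<•U) := by
  set D := ∫⁻ x, ENNReal.ofReal (w x) * ENNReal.ofReal (g x ^ 2) ∂μ with hDdef
  set l := μ + U.variation with hl
  set u := U.rnDeriv l with hu
  have hum : Measurable u := SignedMeasure.measurable_rnDeriv _ _
  have hsm : Measurable (μ.rnDeriv l) := Measure.measurable_rnDeriv _ _
  have hDl : D = ∫⁻ x, μ.rnDeriv l x * (ENNReal.ofReal (w x) * ENNReal.ofReal (g x ^ 2)) ∂l :=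
    lintegral_eq_lintegral_rnDeriv_mul μ U (hw.ennreal_ofReal.mul (hg.pow_const 2).ennreal_ofReal)
  have hDm : Measurable fun x =>
      μ.rnDeriv l x * (ENNReal.ofReal (w x) * ENNReal.ofReal (g x ^ 2)) :=
    hsm.mul (hw.ennreal_ofReal.mul (hg.pow_const 2).ennreal_ofReal)
  have hui : Integrable u l := SignedMeasure.integrable_rnDeriv _ _
  have hA : relAction w 0 μ U
      = ∫⁻ x, alpha (μ.rnDeriv l x) (u x) * ENNReal.ofReal (w x) ∂l := by
    simp [relAction, hl, hu]
  have hAm : Measurable fun x => alpha (μ.rnDeriv l x) (u x) * ENNReal.ofReal (w x) :=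
    (measurable_alpha.comp (hsm.prodMk hum)).mul hw.ennreal_ofReal
  -- If the action is infinite, both sides are `∞`, whatever value the possibly undefined pairing
  -- takes. Otherwise Young's inequality makes the pairing absolutely convergent.
  by_cases hfin : relAction w 0 μ U = ∞
  · have h1 : relAction w 0 μ U ≤ 2 * relAction w g μ U + 2 * D := by
      rw [hA, hDl, relAction, ← lintegral_const_mul' _ _ (by finiteness),
        ← lintegral_const_mul' _ _ (by finiteness), ← lintegral_add_right _ (hDm.const_mul 2)]
      refine lintegral_mono_ae ?_
      filter_upwards [rnDeriv_add_variation_ne_top μ U] with x hx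
      calc _ ≤ (2 * alpha (μ.rnDeriv l x) (u x - (μ.rnDeriv l x).toReal * g x)
            + 2 * (μ.rnDeriv l x * ENNReal.ofReal (g x ^ 2))) * ENNReal.ofReal (w x) := by
            gcongr; exact alpha_le_two_mul hx _ _
        _ = _ := by ring
    have h2 : relAction w g μ U = ∞ := by
      by_contra h
      rw [hfin, top_le_iff] at h1
      exact absurd h1 (by finiteness)
    simp [hfin, h2]
  · have hwg : Integrable (fun x => w x * g x * u x) l := by
      refine ⟨((hw.mul hg).mul hum).aestronglyMeasurable, ?_⟩
      have h1 := lintegral_variation_le_relAction μ U hw hg one_pos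
      have m1 : Measurable fun x => ENNReal.ofReal (w x) * ‖g x‖ₑ :=
        hw.ennreal_ofReal.mul hg.enorm
      rw [lintegral_variation_eq μ U m1] at h1
      refine lt_of_le_of_lt (le_trans (le_of_eq ?_) h1) ?_
      · refine lintegral_congr fun x => ?_
        rw [← Real.enorm_of_nonneg (hw0 x), enorm_mul, enorm_mul]; ring
      · exact ENNReal.add_lt_top.2 ⟨ENNReal.mul_lt_top (by simp) hD.lt_top,
          ENNReal.mul_lt_top (by simp) (lt_top_iff_ne_top.2 hfin)⟩
    have e1 : ∫ᵛ x, w x * g x ∂<•U = ∫ x, w x * g x * u x ∂l := by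
      conv_lhs => rw [← withDensityᵥ_rnDeriv_add_variation μ U]
      exact integral_withDensityᵥ hui
    set P := ∫ᵛ x, w x * g x ∂<•U with hP
    have hpos : Measurable fun x => ENNReal.ofReal (2 * (w x * g x * u x)) := by fun_prop
    have hneg : Measurable fun x => ENNReal.ofReal (2 * -(w x * g x * u x)) := by fun_prop
    have key : relAction w 0 μ U + D + ∫⁻ x, ENNReal.ofReal (2 * -(w x * g x * u x)) ∂l
        = relAction w g μ U + ∫⁻ x, ENNReal.ofReal (2 * (w x * g x * u x)) ∂l := by
      rw [hA, hDl, relAction, ← lintegral_add_right _ hDm, ← lintegral_add_right _ hneg,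
        ← lintegral_add_right _ hpos]
      refine lintegral_congr_ae ?_
      filter_upwards [rnDeriv_add_variation_ne_top μ U] with x hx
      have := congrArg (· * ENNReal.ofReal (w x)) (alpha_add_eq hx (u x) (g x))
      simp only [add_mul] at this
      have a1 : ENNReal.ofReal (2 * (w x * g x * u x))
          = ENNReal.ofReal (2 * (g x * u x)) * ENNReal.ofReal (w x) := by
        rw [← ENNReal.ofReal_mul' (hw0 x)]; congr 1; ring
      have a2 : ENNReal.ofReal (2 * -(w x * g x * u x))
          = ENNReal.ofReal (2 * -(g x * u x)) * ENNReal.ofReal (w x) := by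
        rw [← ENNReal.ofReal_mul' (hw0 x)]; congr 1; ring
      rw [a1, a2, ← this]
      ring
    have hi2 : Integrable (fun x => 2 * (w x * g x * u x)) l := hwg.const_mul 2
    have hPe : 2 * P = (∫⁻ x, ENNReal.ofReal (2 * (w x * g x * u x)) ∂l).toReal
        - (∫⁻ x, ENNReal.ofReal (2 * -(w x * g x * u x)) ∂l).toReal := by
      rw [e1, ← integral_const_mul, integral_eq_lintegral_pos_part_sub_lintegral_neg_part hi2]
      simp only [mul_neg]
    have f1 : ∫⁻ x, ENNReal.ofReal (2 * (w x * g x * u x)) ∂l ≠ ∞ :=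
      (Integrable.lintegral_lt_top hi2).ne
    have f2 : ∫⁻ x, ENNReal.ofReal (2 * -(w x * g x * u x)) ∂l ≠ ∞ := by
      simp only [mul_neg]
      exact (Integrable.lintegral_lt_top hi2.neg).ne
    set a := ∫⁻ x, ENNReal.ofReal (2 * (w x * g x * u x)) ∂l
    set b := ∫⁻ x, ENNReal.ofReal (2 * -(w x * g x * u x)) ∂l
    have hR : relAction w g μ U ≠ ∞ := by
      intro h
      rw [h, top_add] at key
      exact absurd key (by finiteness)
    have key' := congrArg ENNReal.toReal key
    rw [ENNReal.toReal_add (by finiteness) f2, ENNReal.toReal_add hR f1] at key'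
    refine (ENNReal.toReal_eq_toReal_iff' (by finiteness) (by finiteness)).1 ?_
    rw [ENNReal.toReal_add (by finiteness) (by finiteness), ENNReal.toReal_add hR (by finiteness),
      ENNReal.toReal_ofReal', ENNReal.toReal_ofReal']
    have : max (2 * P) 0 - max (2 * -P) 0 = 2 * P := by
      rw [mul_neg, max_zero_sub_max_neg_zero_eq_self]
    linarith

/-- By uniqueness of densities, `g μ` has density `s g` with respect to the reference measure, and
`α(s, s g)` is at most `s g²`. -/
lemma relAction_withDensityᵥ_le (hw : Measurable w) (hg : Measurable g) (hgi : Integrable g μ) :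
    relAction w 0 μ (μ.withDensityᵥ g)
      ≤ ∫⁻ x, ENNReal.ofReal (w x) * ENNReal.ofReal (g x ^ 2) ∂μ := by
  set U : SignedMeasure X := μ.withDensityᵥ g with hU
  set l := μ + U.variation with hl
  have hac := absolutelyContinuous_add_variation μ U
  have h1 : U.rnDeriv l =ᵐ[l] fun x => (μ.rnDeriv l x).toReal • g x := by
    refine Integrable.ae_eq_of_withDensityᵥ_eq (SignedMeasure.integrable_rnDeriv _ _)
      ((integrable_rnDeriv_smul_iff hac).2 hgi) ?_
    rw [withDensityᵥ_rnDeriv_add_variation, withDensityᵥ_rnDeriv_smul hac hgi]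
  have m2 : Measurable fun x => ENNReal.ofReal (w x) * ENNReal.ofReal (g x ^ 2) :=
    hw.ennreal_ofReal.mul (hg.pow_const 2).ennreal_ofReal
  rw [relAction, lintegral_eq_lintegral_rnDeriv_mul μ U m2]
  refine lintegral_mono_ae ?_
  filter_upwards [rnDeriv_add_variation_ne_top μ U, h1] with x hx hx1
  rw [hx1]
  simp only [Pi.zero_apply, mul_zero, sub_zero, smul_eq_mul]
  calc _ ≤ μ.rnDeriv l x * ENNReal.ofReal (g x ^ 2) * ENNReal.ofReal (w x) := by
        gcongr; exact alpha_mul_self_le hx _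
    _ = _ := by ring

end Action

/-! ### Weights, moments and product measures off the diagonal. -/

section OffDiag

open ProbabilityTheory Function

/-- The relative velocity `v - v⋆`. -/
def relVel (p : OffDiag) : ℝ := p.1.1 - p.1.2

lemma measurable_relVel : Measurable relVel := by unfold relVel; fun_prop

lemma measurable_sigma (e : ℝ) : Measurable (sigma e) := by unfold sigma; fun_prop

lemma sigma_nonneg {e : ℝ} (he : e < 1) (p : OffDiag) : 0 ≤ sigma e p := by
  unfold sigma; have : 0 ≤ 1 - e := by linarith
  positivity

lemma nlGrad_energyVariation (p : OffDiag) : nlGrad energyVariation p = -relVel p := by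
  have : ∀ v, deriv energyVariation v = v := fun v => by
    have h : HasDerivAt (fun x : ℝ => x ^ 2 / 2) v v := by
      simpa using (hasDerivAt_pow 2 v).div_const 2
    exact h.deriv
  rw [nlGrad, this, this, relVel]; ring

lemma energyFlux_eq (f : ProbabilityMeasure ℝ) :
    energyFlux f = (prodOff f).withDensityᵥ relVel := by
  rw [energyFlux]; congr 1; ext p; rw [nlGrad_energyVariation, neg_neg]

lemma continuous_nlGrad {φ : ℝ → ℝ} (hφ : ContDiff ℝ 1 φ) : Continuous (nlGrad φ) := by
  have := hφ.continuous_deriv le_rfl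
  unfold nlGrad; fun_prop

lemma abs_nlGrad_le {φ : ℝ → ℝ} {L : ℝ} (hL : ∀ v, |deriv φ v| ≤ L) (p : OffDiag) :
    |nlGrad φ p| ≤ 2 * L :=
  (abs_sub _ _).trans (by linarith [hL p.1.1, hL p.1.2])

lemma measurableEmbedding_offDiag : MeasurableEmbedding (Subtype.val : OffDiag → ℝ × ℝ) :=
  MeasurableEmbedding.subtype_coe
    (measurableSet_eq_fun measurable_fst measurable_snd).compl

lemma lintegral_prodOff_le (f : ProbabilityMeasure ℝ) (F : ℝ × ℝ → ℝ≥0∞) :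
    ∫⁻ p, F p.1 ∂(prodOff f) ≤ ∫⁻ p, F p ∂((f : Measure ℝ).prod (f : Measure ℝ)) := by
  have h : ∫⁻ p, F p.1 ∂(prodOff f)
      = ∫⁻ p in {p : ℝ × ℝ | p.1 ≠ p.2}, F p ∂((f : Measure ℝ).prod (f : Measure ℝ)) :=
    lintegral_subtype_comap (measurableSet_eq_fun measurable_fst measurable_snd).compl F
  rw [h]
  exact setLIntegral_le_lintegral _ _

instance isFiniteMeasure_prodOff (f : ProbabilityMeasure ℝ) : IsFiniteMeasure (prodOff f) := by
  constructor
  have := lintegral_prodOff_le f 1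
  simp only [Pi.one_apply, lintegral_one, measure_univ] at this
  exact this.trans_lt ENNReal.one_lt_top

lemma action_eq_relAction (e : ℝ) (f : ProbabilityMeasure ℝ) (U : SignedMeasure OffDiag) :
    action e f U = relAction (sigma e) 0 (prodOff f) U := by
  simp [action, relAction]

lemma dissipation_eq (e : ℝ) (f : ProbabilityMeasure ℝ) :
    dissipation e f
      = ∫⁻ p, ENNReal.ofReal (sigma e p) * ENNReal.ofReal (relVel p ^ 2) ∂(prodOff f) := by
  refine lintegral_congr fun p => ?_
  rw [← ENNReal.ofReal_mul' (sq_nonneg _), sq_abs, mul_comm, relVel]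

lemma lintegral_sq_ne_top {f : ProbabilityMeasure ℝ} (hf : f ∈ P2cm) :
    ∫⁻ v, ENNReal.ofReal (v ^ 2) ∂(f : Measure ℝ) ≠ ∞ :=
  hf.1.lintegral_lt_top.ne

lemma integrable_relVel_sq {f : ProbabilityMeasure ℝ} (hf : f ∈ P2cm) :
    Integrable (fun p => relVel p ^ 2) (prodOff f) := by
  refine ⟨(measurable_relVel.pow_const 2).aestronglyMeasurable, ?_⟩
  rw [hasFiniteIntegral_iff_ofReal (.of_forall fun p => sq_nonneg _)]
  refine (lintegral_prodOff_le f fun q => ENNReal.ofReal ((q.1 - q.2) ^ 2)).trans_lt ?_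
  have h1 : ∫⁻ q : ℝ × ℝ, ENNReal.ofReal ((q.1 - q.2) ^ 2) ∂((f : Measure ℝ).prod f)
      ≤ ∫⁻ q : ℝ × ℝ, (2 * ENNReal.ofReal (q.1 ^ 2) + 2 * ENNReal.ofReal (q.2 ^ 2))
        ∂((f : Measure ℝ).prod f) := by
    refine lintegral_mono fun q => ?_
    have e2 : (2 : ℝ≥0∞) = ENNReal.ofReal 2 := by simp
    rw [e2, ← ENNReal.ofReal_mul (by norm_num), ← ENNReal.ofReal_mul (by norm_num),
      ← ENNReal.ofReal_add (by positivity) (by positivity)]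
    exact ENNReal.ofReal_le_ofReal (by nlinarith [sq_nonneg (q.1 + q.2)])
  refine h1.trans_lt ?_
  have hm : Measurable fun v : ℝ => ENNReal.ofReal (v ^ 2) := by fun_prop
  rw [lintegral_add_left (by fun_prop), lintegral_const_mul _ (by fun_prop),
    lintegral_const_mul _ (by fun_prop),
    lintegral_prod _ (by fun_prop), lintegral_prod _ (by fun_prop)]
  have := lintegral_sq_ne_top hf
  simp only [lintegral_const, measure_univ, mul_one]
  finiteness

lemma integrable_relVel {f : ProbabilityMeasure ℝ} (hf : f ∈ P2cm) :
    Integrable relVel (prodOff f) := by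
  refine Integrable.mono' ((integrable_relVel_sq hf).add (integrable_const (1 : ℝ)))
    measurable_relVel.aestronglyMeasurable (.of_forall fun p => ?_)
  simp only [Real.norm_eq_abs, Pi.add_apply]
  rw [abs_le]; constructor <;> nlinarith [sq_nonneg (relVel p - 1), sq_nonneg (relVel p + 1)]

lemma integrable_sigma_mul_relVel {e : ℝ} {f : ProbabilityMeasure ℝ} (hf : f ∈ P2cm) :
    Integrable (fun p => sigma e p * relVel p) (prodOff f) := by
  refine ((integrable_relVel_sq hf).const_mul |(1 - e) / 4|).mono'
    ((measurable_sigma e).mul measurable_relVel).aestronglyMeasurable (.of_forall fun p => ?_)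
  rw [norm_mul, sigma, Real.norm_eq_abs, Real.norm_eq_abs, abs_mul, abs_abs, ← relVel, mul_assoc,
    abs_mul_abs_self, sq]

variable {α : Type*} [MeasurableSpace α]

lemma measurable_curve {c : α → ProbabilityMeasure ℝ}
    (hc : ∀ B : Set ℝ, MeasurableSet B → Measurable fun a => (c a : Measure ℝ) B) :
    Measurable fun a => (c a : Measure ℝ) :=
  Measure.measurable_of_measurable_coe _ hc

lemma measurable_prodOff {c : α → ProbabilityMeasure ℝ}
    (hc : ∀ B : Set ℝ, MeasurableSet B → Measurable fun a => (c a : Measure ℝ) B) :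
    Measurable fun a => prodOff (c a) := by
  let κ : Kernel α ℝ := ⟨fun a => (c a : Measure ℝ), measurable_curve hc⟩
  have : IsMarkovKernel κ := ⟨fun a => (c a).2⟩
  have h := ((κ ×ₖ κ).comapRight measurableEmbedding_offDiag).measurable
  have e : ∀ a, (κ ×ₖ κ).comapRight measurableEmbedding_offDiag a = prodOff (c a) := fun a => by
    rw [Kernel.comapRight_apply, Kernel.prod_apply]; rfl
  simpa only [funext e] using h

lemma measurable_lintegral_prodOff {c : α → ProbabilityMeasure ℝ}
    (hc : ∀ B : Set ℝ, MeasurableSet B → Measurable fun a => (c a : Measure ℝ) B)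
    {F : α → OffDiag → ℝ≥0∞} (hF : Measurable (uncurry F)) :
    Measurable fun a => ∫⁻ p, F a p ∂(prodOff (c a)) := by
  let κ : Kernel α OffDiag := ⟨fun a => prodOff (c a), measurable_prodOff hc⟩
  have : IsSFiniteKernel κ := isSFiniteKernel_of_isFiniteMeasure κ fun a =>
    isFiniteMeasure_prodOff (c a)
  exact Measurable.lintegral_kernel_prod_right (κ := κ) hF

lemma measurable_integral_prodOff {c : α → ProbabilityMeasure ℝ}
    (hc : ∀ B : Set ℝ, MeasurableSet B → Measurable fun a => (c a : Measure ℝ) B)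
    {F : α → OffDiag → ℝ} (hF : Measurable (uncurry F)) :
    Measurable fun a => ∫ p, F a p ∂(prodOff (c a)) := by
  let κ : Kernel α OffDiag := ⟨fun a => prodOff (c a), measurable_prodOff hc⟩
  have : IsSFiniteKernel κ := isSFiniteKernel_of_isFiniteMeasure κ fun a =>
    isFiniteMeasure_prodOff (c a)
  exact (hF.stronglyMeasurable.integral_kernel_prod_right (κ := κ)).measurable

lemma measurable_integral_curve {c : α → ProbabilityMeasure ℝ}
    (hc : ∀ B : Set ℝ, MeasurableSet B → Measurable fun a => (c a : Measure ℝ) B)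
    {φ : ℝ → ℝ} (hφ : Measurable φ) :
    Measurable fun a => ∫ v, φ v ∂(c a : Measure ℝ) := by
  let κ : Kernel α ℝ := ⟨fun a => (c a : Measure ℝ), measurable_curve hc⟩
  exact (hφ.stronglyMeasurable.integral_kernel (κ := κ)).measurable

end OffDiag

/-! ### Measurability in time along solutions. -/

section TimeMeasurability

open Function

variable {e T : ℝ} {f : ℝ → ProbabilityMeasure ℝ} {U : ℝ → SignedMeasure OffDiag}

lemma measurable_uncurry_subtype {β : Type*} [MeasurableSpace β] {F : ℝ → OffDiag → β}
    (hF : Measurable (uncurry F)) :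
    Measurable (uncurry fun (t : Icc (0 : ℝ) T) p => F t p) :=
  hF.comp ((measurable_subtype_coe.comp measurable_fst).prodMk measurable_snd)

lemma IsGCE.aemeasurable_integral_flux (h : IsGCE e T f U) {F : ℝ → OffDiag → ℝ}
    (hF : Measurable (uncurry F)) :
    AEMeasurable (fun t => ∫ᵛ p, F t p ∂<•(U t)) (volume.restrict (Icc 0 T)) :=
  aemeasurable_restrict_of_measurable_subtype measurableSet_Icc
    (measurable_integral_signedMeasure h.measurable_flux (measurable_uncurry_subtype hF))

lemma IsGCE.aemeasurable_lintegral_flux (h : IsGCE e T f U) {F : OffDiag → ℝ≥0∞}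
    (hF : Measurable F) :
    AEMeasurable (fun t => ∫⁻ p, F p ∂(U t).variation) (volume.restrict (Icc 0 T)) :=
  aemeasurable_restrict_of_measurable_subtype measurableSet_Icc
    (measurable_lintegral_variation h.measurable_flux (hF.comp measurable_snd))

lemma IsGCE.aemeasurable_lintegral_prodOff (h : IsGCE e T f U) {F : OffDiag → ℝ≥0∞}
    (hF : Measurable F) :
    AEMeasurable (fun t => ∫⁻ p, F p ∂(prodOff (f t))) (volume.restrict (Icc 0 T)) :=
  aemeasurable_restrict_of_measurable_subtype measurableSet_Icc
    (measurable_lintegral_prodOff h.measurable_curve (hF.comp measurable_snd))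

lemma IsGCE.aemeasurable_integral_curve (h : IsGCE e T f U) {φ : ℝ → ℝ} (hφ : Measurable φ) :
    AEMeasurable (fun t => ∫ v, φ v ∂(f t : Measure ℝ)) (volume.restrict (Icc 0 T)) :=
  aemeasurable_restrict_of_measurable_subtype measurableSet_Icc
    (measurable_integral_curve h.measurable_curve hφ)

end TimeMeasurability

/-! ### The continuity equation tested with functions of the velocity. -/

section WeakFormulation

open Function Filter Topology

variable {e T : ℝ} {f : ℝ → ProbabilityMeasure ℝ} {U : ℝ → SignedMeasure OffDiag}

/-- The total mass `∫₀ᵀ ∬ σ_e d|U_t| dt` of the flux. -/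
def fluxMass (e T : ℝ) (U : ℝ → SignedMeasure OffDiag) : ℝ≥0∞ :=
  ∫⁻ t in Icc 0 T, ∫⁻ p, ENNReal.ofReal (sigma e p) ∂(U t).variation

/-- The exceptional null set depends on `H` only, so the conclusion may be used at time `t` for an
`F` that itself depends on `t`. -/
lemma IsGCE.ae_integrable (h : IsGCE e T f U) {H : OffDiag → ℝ} (hH : Measurable H)
    (hfin : ∫⁻ t in Icc 0 T, ∫⁻ p, ENNReal.ofReal (H p) ∂(U t).variation ≠ ∞) :
    ∀ᵐ t ∂volume.restrict (Icc 0 T), ∀ F : OffDiag → ℝ, Measurable F → (∀ p, |F p| ≤ H p) →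
      Integrable F (U t).variation := by
  filter_upwards [ae_lt_top' (h.aemeasurable_lintegral_flux hH.ennreal_ofReal) hfin]
    with t ht F hF hFH
  refine ⟨hF.aestronglyMeasurable, lt_of_le_of_lt (lintegral_mono fun p => ?_) ht⟩
  rw [← ofReal_norm]
  exact ENNReal.ofReal_le_ofReal (hFH p)

lemma enorm_integral_flux_le (V : SignedMeasure OffDiag) {F H : OffDiag → ℝ}
    (hFH : ∀ p, |F p| ≤ H p) :
    ‖∫ᵛ p, F p ∂<•V‖ₑ ≤ ∫⁻ p, ENNReal.ofReal (H p) ∂V.variation := by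
  refine (VectorMeasure.enorm_integral_le_lintegral_enorm_transpose).trans ?_
  rw [VectorMeasure.variation_transpose_lsmul_flip]
  refine lintegral_mono fun p => ?_
  rw [← ofReal_norm]
  exact ENNReal.ofReal_le_ofReal (hFH p)

lemma IsGCE.integrable_integral_flux (h : IsGCE e T f U) {F : ℝ → OffDiag → ℝ}
    (hF : Measurable (uncurry F)) {H : OffDiag → ℝ} (hFH : ∀ t p, |F t p| ≤ H p)
    (hfin : ∫⁻ t in Icc 0 T, ∫⁻ p, ENNReal.ofReal (H p) ∂(U t).variation ≠ ∞) :
    IntegrableOn (fun t => ∫ᵛ p, F t p ∂<•(U t)) (Icc 0 T) :=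
  ⟨(h.aemeasurable_integral_flux hF).aestronglyMeasurable,
    (lintegral_mono fun t => enorm_integral_flux_le (U t) (hFH t)).trans_lt
      (lt_top_iff_ne_top.2 hfin)⟩

lemma abs_sigma_mul_nlGrad_le (he : e < 1) {φ : ℝ → ℝ} {L : ℝ} (hL : ∀ v, |deriv φ v| ≤ L)
    (p : OffDiag) : |sigma e p * nlGrad φ p| ≤ 2 * L * sigma e p := by
  rw [abs_mul, abs_of_nonneg (sigma_nonneg he p), mul_comm]
  exact mul_le_mul_of_nonneg_right (abs_nlGrad_le hL p) (sigma_nonneg he p)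

lemma lintegral_const_mul_sigma {C : ℝ} (hC : 0 ≤ C) (T : ℝ) (U : ℝ → SignedMeasure OffDiag) :
    ∫⁻ t in Icc 0 T, ∫⁻ p, ENNReal.ofReal (C * sigma e p) ∂(U t).variation
      = ENNReal.ofReal C * fluxMass e T U := by
  simp_rw [ENNReal.ofReal_mul hC]
  rw [fluxMass, ← lintegral_const_mul' _ _ ENNReal.ofReal_ne_top]
  refine lintegral_congr fun t => ?_
  rw [lintegral_const_mul' _ _ ENNReal.ofReal_ne_top]

lemma measurable_sigma_mul_nlGrad {φ : ℝ → ℝ} (hφ : ContDiff ℝ 1 φ) :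
    Measurable fun p => sigma e p * nlGrad φ p :=
  (measurable_sigma e).mul (continuous_nlGrad hφ).measurable

/-- The weak formulation against a test function of the velocity alone, between two times at
which the integral of the test function is continuous. -/
lemma IsGCE.sub_eq_setIntegral (he : e < 1) (h : IsGCE e T f U) {φ : ℝ → ℝ}
    (hφ : ContDiff ℝ 1 φ) (hφc : HasCompactSupport φ) {a b : ℝ} (ha : 0 ≤ a) (hab : a < b)
    (hb : b ≤ T)
    (hFa : ContinuousWithinAt (fun t => ∫ v, φ v ∂(f t : Measure ℝ)) (Icc a b) a)
    (hFb : ContinuousWithinAt (fun t => ∫ v, φ v ∂(f t : Measure ℝ)) (Icc a b) b) :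
    ∫ v, φ v ∂(f b : Measure ℝ) - ∫ v, φ v ∂(f a : Measure ℝ)
      = ∫ t in Icc a b, ∫ᵛ p, sigma e p * nlGrad φ p ∂<•(U t) := by
  obtain ⟨L, hL⟩ := (hφ.continuous_deriv le_rfl).bounded_above_of_compact_support hφc.deriv
  have hL0 : 0 ≤ L := (norm_nonneg _).trans (hL 0)
  obtain ⟨M, hM⟩ := hφ.continuous.bounded_above_of_compact_support hφc
  refine sub_eq_setIntegral_of_weakDeriv (T := T) (F := fun t => ∫ v, φ v ∂(f t : Measure ℝ))
    (G := fun t => ∫ᵛ p, sigma e p * nlGrad φ p ∂<•(U t)) ha hab hb ?_ ?_ ?_ hFa hFb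
  · refine Integrable.of_bound
      (h.aemeasurable_integral_curve hφ.continuous.measurable).aestronglyMeasurable M
      (.of_forall fun t => ?_)
    simpa using norm_integral_le_of_norm_le_const (μ := (f t : Measure ℝ)) (.of_forall hM)
  · refine h.integrable_integral_flux (F := fun _ p => sigma e p * nlGrad φ p)
      ((measurable_sigma_mul_nlGrad hφ).comp measurable_snd)
      (fun _ => abs_sigma_mul_nlGrad_le he hL) ?_
    rw [lintegral_const_mul_sigma (by positivity)]
    exact ENNReal.mul_ne_top ENNReal.ofReal_ne_top h.integrability.ne
  · intro η hη hηc hηT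
    have hc : HasCompactSupport fun q : ℝ × ℝ => η q.1 * φ q.2 := by
      refine HasCompactSupport.of_support_subset_isCompact (hηc.isCompact.prod hφc.isCompact)
        fun q hq => ⟨subset_tsupport _ (left_ne_zero_of_mul hq),
          subset_tsupport _ (right_ne_zero_of_mul hq)⟩
    have hts : tsupport (fun q : ℝ × ℝ => η q.1 * φ q.2) ⊆ Ioo 0 T ×ˢ univ := by
      refine Subset.trans (closure_minimal (t := tsupport η ×ˢ univ) (fun q hq =>
        ⟨subset_tsupport _ (left_ne_zero_of_mul hq), trivial⟩)
        ((isClosed_tsupport η).prod isClosed_univ)) (prod_mono hηT subset_rfl)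
    have := h.weak_form (fun q => η q.1 * φ q.2)
      ((hη.comp contDiff_fst).mul (hφ.comp contDiff_snd)) hc hts
    convert this using 2
    · refine integral_congr_ae (.of_forall fun t => ?_)
      beta_reduce
      rw [← integral_const_mul]
      refine integral_congr_ae (.of_forall fun v => ?_)
      dsimp only
      rw [deriv_mul_const (hη.differentiable one_ne_zero t)]
    · refine integral_congr_ae (.of_forall fun t => ?_)
      beta_reduce
      rw [← smul_eq_mul, ← VectorMeasure.integral_fun_smul]
      congr 1
      ext p
      simp only [nlGrad, smul_eq_mul]
      rw [deriv_const_mul _ (hφ.differentiable one_ne_zero _),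
        deriv_const_mul _ (hφ.differentiable one_ne_zero _)]
      ring

/-- Narrow continuity makes every pair of times admissible. Only the slope bound of `φ` enters the
estimate, so it survives the removal of a cutoff. -/
lemma IsGCE.ofReal_abs_sub_le (he : e < 1) (h : IsGCE e T f U) (hf : ContinuousOn f (Icc 0 T))
    {φ : ℝ → ℝ} (hφ : ContDiff ℝ 1 φ) (hφc : HasCompactSupport φ) {L : ℝ}
    (hL : ∀ v, |deriv φ v| ≤ L) {a b : ℝ} (ha : a ∈ Icc 0 T) (hb : b ∈ Icc 0 T) :
    ENNReal.ofReal |∫ v, φ v ∂(f b : Measure ℝ) - ∫ v, φ v ∂(f a : Measure ℝ)|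
      ≤ ENNReal.ofReal (2 * L) * fluxMass e T U := by
  have hL0 : 0 ≤ L := (abs_nonneg _).trans (hL 0)
  wlog hab : a < b generalizing a b with H
  · rcases eq_or_lt_of_le (not_lt.1 hab) with rfl | hlt
    · simp
    · rw [abs_sub_comm]; exact H hb ha hlt
  have hcont : ∀ c ∈ Icc a b,
      ContinuousWithinAt (fun t => ∫ v, φ v ∂(f t : Measure ℝ)) (Icc a b) c := fun c hc =>
    (ProbabilityMeasure.tendsto_iff_forall_integral_tendsto.1
      (hf.mono (Icc_subset_Icc ha.1 hb.2) c hc))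
      (ofCompactSupport φ hφ.continuous hφc)
  rw [h.sub_eq_setIntegral he hφ hφc ha.1 hab hb.2 (hcont a (left_mem_Icc.2 hab.le))
    (hcont b (right_mem_Icc.2 hab.le)), ← Real.norm_eq_abs, ofReal_norm,
    ← lintegral_const_mul_sigma (by positivity)]
  refine (enorm_integral_le_lintegral_enorm _).trans ?_
  refine le_trans (lintegral_mono fun t =>
    enorm_integral_flux_le (U t) (abs_sigma_mul_nlGrad_le he hL)) ?_
  exact lintegral_mono_set (Icc_subset_Icc ha.1 hb.2)

end WeakFormulation

/-! ### The collision distance controls integrals of test functions. -/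

section CollisionDistance

open Function Filter Topology

variable {e T : ℝ}

/-- A moment that is comparable to the first absolute moment. -/
def huberMoment (f : ProbabilityMeasure ℝ) : ℝ≥0∞ :=
  ∫⁻ v, ENNReal.ofReal (huber 1 v) ∂(f : Measure ℝ)

lemma huberMoment_ne_top {f : ProbabilityMeasure ℝ} (hf : f ∈ P2cm) : huberMoment f ≠ ∞ := by
  refine ne_top_of_le_ne_top (lintegral_sq_ne_top hf) (lintegral_mono fun v => ?_)
  exact ENNReal.ofReal_le_ofReal ((huber_le v).trans (by nlinarith [sq_nonneg v]))

lemma lintegral_sigma_prodOff_le (he₀ : 0 ≤ e) (f : ProbabilityMeasure ℝ) :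
    ∫⁻ p, ENNReal.ofReal (sigma e p) ∂(prodOff f) ≤ huberMoment f + 1 := by
  have hm : Measurable (huber 1) := (contDiff_huber zero_le_one).continuous.measurable
  have h1 : ∫⁻ p, ENNReal.ofReal (sigma e p) ∂(prodOff f)
      ≤ ∫⁻ q : ℝ × ℝ, ENNReal.ofReal ((huber 1 q.1 + huber 1 q.2 + 1) / 2)
        ∂((f : Measure ℝ).prod f) := by
    refine (lintegral_mono fun p => ?_).trans (lintegral_prodOff_le f _)
    refine ENNReal.ofReal_le_ofReal ?_
    unfold sigma
    have a1 := abs_sub p.1.1 p.1.2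
    have a2 := abs_le_huber_one_add p.1.1
    have a3 := abs_le_huber_one_add p.1.2
    have a4 := abs_nonneg (p.1.1 - p.1.2)
    nlinarith
  refine h1.trans ?_
  have h2 : ∀ q : ℝ × ℝ, ENNReal.ofReal ((huber 1 q.1 + huber 1 q.2 + 1) / 2)
      = (ENNReal.ofReal (huber 1 q.1) + ENNReal.ofReal (huber 1 q.2) + 1) * 2⁻¹ := fun q => by
    have a1 := huber_nonneg zero_le_one q.1
    have a2 := huber_nonneg zero_le_one q.2
    rw [ENNReal.ofReal_div_of_pos two_pos, ENNReal.ofReal_add (by positivity) one_pos.le,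
      ENNReal.ofReal_add a1 a2]
    simp [div_eq_mul_inv]
  simp_rw [h2]
  rw [lintegral_mul_const _ (by fun_prop), lintegral_add_right _ measurable_const,
    lintegral_add_left (by fun_prop), lintegral_prod _ (by fun_prop),
    lintegral_prod _ (by fun_prop)]
  simp only [lintegral_const, measure_univ, mul_one]
  change (huberMoment f + huberMoment f + 1) * 2⁻¹ ≤ _
  rw [← two_mul, add_mul, mul_comm 2, mul_assoc, ENNReal.mul_inv_cancel (by simp) (by simp),
    mul_one, one_mul]
  gcongr
  simp

/-- Along a continuous solution, the moment grows at most by a multiple of the flux mass. -/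
lemma exists_huberMoment_le : ∃ C : ℝ, 0 ≤ C ∧ ∀ (e T : ℝ) (f : ℝ → ProbabilityMeasure ℝ)
    (U : ℝ → SignedMeasure OffDiag), e < 1 → IsGCE e T f U → ContinuousOn f (Icc 0 T) →
    ∀ a ∈ Icc 0 T, ∀ b ∈ Icc 0 T,
      huberMoment (f b) ≤ huberMoment (f a) + ENNReal.ofReal C * fluxMass e T U := by
  have hh := contDiff_huber zero_le_one
  obtain ⟨ψ, C, hψ, hψc, hψC, hψle, hψ0, hψt⟩ :=
    exists_cutoff hh (abs_deriv_huber_le zero_le_one)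
  have hC : 0 ≤ C := (abs_nonneg _).trans (hψC 0 0)
  have hn : ∀ n v, 0 ≤ ψ n v := fun n v => hψ0 n v (huber_nonneg zero_le_one v)
  refine ⟨2 * C, by positivity, fun e T f U he h hf a ha b hb => ?_⟩
  have hi : ∀ n t, Integrable (ψ n) (f t : Measure ℝ) := fun n t =>
    ((hψ n).continuous.integrable_of_hasCompactSupport (hψc n))
  have key : ∀ n, ∫⁻ v, ENNReal.ofReal (ψ n v) ∂(f b : Measure ℝ)
      ≤ huberMoment (f a) + ENNReal.ofReal (2 * C) * fluxMass e T U := fun n => by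
    have h1 := h.ofReal_abs_sub_le he hf (hψ n) (hψc n) (hψC n) ha hb
    rw [← ofReal_integral_eq_lintegral_ofReal (hi n b) (.of_forall (hn n))]
    calc _ ≤ ENNReal.ofReal (∫ v, ψ n v ∂(f a : Measure ℝ)
            + |∫ v, ψ n v ∂(f b : Measure ℝ) - ∫ v, ψ n v ∂(f a : Measure ℝ)|) :=
          ENNReal.ofReal_le_ofReal (sub_le_iff_le_add'.1 (le_abs_self _))
      _ ≤ _ := ENNReal.ofReal_add_le
      _ ≤ _ := by
          refine add_le_add ?_ h1
          rw [ofReal_integral_eq_lintegral_ofReal (hi n a) (.of_forall (hn n))]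
          refine lintegral_mono fun v => ENNReal.ofReal_le_ofReal ?_
          have := hψle n v
          rwa [abs_of_nonneg (hn n v), abs_of_nonneg (huber_nonneg zero_le_one v)] at this
  -- Fatou's lemma removes the cutoff; finiteness of the moment at time `b` is not presupposed.
  have h2 : huberMoment (f b)
      ≤ liminf (fun n => ∫⁻ v, ENNReal.ofReal (ψ n v) ∂(f b : Measure ℝ)) atTop := by
    refine le_trans (lintegral_mono fun v => ?_)
      (lintegral_liminf_le fun n => (hψ n).continuous.measurable.ennreal_ofReal)
    refine le_of_eq (Tendsto.liminf_eq ?_).symm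
    refine tendsto_const_nhds.congr' ?_
    filter_upwards [hψt v] with n hn
    rw [hn.self_of_nhds]
  refine h2.trans (liminf_le_of_le (by isBoundedDefault) fun x hx => ?_)
  obtain ⟨n, hn⟩ := hx.exists
  exact hn.trans (key n)

/-- The flux mass is controlled by the action. -/
lemma fluxMass_le (he₀ : 0 ≤ e) {f : ℝ → ProbabilityMeasure ℝ}
    {U : ℝ → SignedMeasure OffDiag} {S : ℝ≥0∞}
    (hS : ∀ t ∈ Icc (0 : ℝ) 1, huberMoment (f t) ≤ S) {δ : ℝ} (hδ : 0 < δ) :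
    fluxMass e 1 U ≤ ENNReal.ofReal δ * (S + 1)
      + ENNReal.ofReal (1 / (4 * δ)) * ∫⁻ t in Icc (0 : ℝ) 1, action e (f t) (U t) := by
  have key : ∀ t ∈ Icc (0 : ℝ) 1, ∫⁻ p, ENNReal.ofReal (sigma e p) ∂(U t).variation
      ≤ ENNReal.ofReal δ * (S + 1) + ENNReal.ofReal (1 / (4 * δ)) * action e (f t) (U t) := by
    intro t ht
    have := lintegral_variation_le_relAction (prodOff (f t)) (U t) (measurable_sigma e)
      (h := fun _ => 1) measurable_const hδ
    simp only [enorm_one, mul_one, one_pow, ENNReal.ofReal_one, ← action_eq_relAction] at this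
    refine this.trans ?_
    gcongr
    exact (lintegral_sigma_prodOff_le he₀ (f t)).trans (by gcongr; exact hS t ht)
  refine (setLIntegral_mono' measurableSet_Icc key).trans ?_
  rw [lintegral_add_left measurable_const,
    lintegral_const_mul' (ENNReal.ofReal (1 / (4 * δ))) _ ENNReal.ofReal_ne_top]
  simp

/-- The action bounds the flux mass up to `δ` times a moment, and the moment is bounded by its value
at one time plus `C` times the flux mass. For `δ C ≤ 1/2` the flux mass on the right is absorbed,
which is legitimate because it is finite by the definition of a solution. -/
lemma exists_fluxMass_le : ∃ C : ℝ, 0 ≤ C ∧ ∀ (e : ℝ) (f : ℝ → ProbabilityMeasure ℝ)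
    (U : ℝ → SignedMeasure OffDiag), 0 ≤ e → e < 1 → IsGCE e 1 f U → ContinuousOn f (Icc 0 1) →
    ∀ a ∈ Icc (0 : ℝ) 1, ∀ δ, 0 < δ → δ * C ≤ 1 / 2 →
      fluxMass e 1 U ≤ 2 * (ENNReal.ofReal δ * (huberMoment (f a) + 1)
        + ENNReal.ofReal (1 / (4 * δ)) * ∫⁻ t in Icc (0 : ℝ) 1, action e (f t) (U t)) := by
  obtain ⟨C, hC, hb⟩ := exists_huberMoment_le
  refine ⟨C, hC, fun e f U he₀ he h hf a ha δ hδ hδC => ?_⟩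
  have h1 := fluxMass_le he₀ (U := U) (fun t ht => hb e 1 f U he h hf a ha t ht) hδ
  set N := fluxMass e 1 U with hN
  set A := ∫⁻ t in Icc (0 : ℝ) 1, action e (f t) (U t)
  have hNfin : N ≠ ∞ := h.integrability.ne
  have h2 : N ≤ ENNReal.ofReal δ * (huberMoment (f a) + 1) + ENNReal.ofReal (1 / (4 * δ)) * A
      + N / 2 := by
    refine h1.trans ?_
    have : ENNReal.ofReal δ * (ENNReal.ofReal C * N) ≤ N / 2 := by
      rw [← mul_assoc, ← ENNReal.ofReal_mul hδ.le, div_eq_mul_inv, mul_comm N]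
      gcongr
      refine (ENNReal.ofReal_le_ofReal hδC).trans (le_of_eq ?_)
      rw [one_div, ENNReal.ofReal_inv_of_pos two_pos]; simp
    calc _ = ENNReal.ofReal δ * (huberMoment (f a) + 1) + ENNReal.ofReal (1 / (4 * δ)) * A
          + ENNReal.ofReal δ * (ENNReal.ofReal C * N) := by ring
      _ ≤ _ := by gcongr
  set X := ENNReal.ofReal δ * (huberMoment (f a) + 1) + ENNReal.ofReal (1 / (4 * δ)) * A
  have h3 : N / 2 ≤ X := by
    have : N / 2 + N / 2 ≤ X + N / 2 := by rwa [ENNReal.add_halves]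
    exact (ENNReal.add_le_add_iff_right (ENNReal.div_ne_top hNfin two_ne_zero)).1 this
  calc N = 2 * (N / 2) := (ENNReal.mul_div_cancel two_ne_zero (by simp)).symm
    _ ≤ 2 * X := by gcongr

/-- Convergence in the collision distance implies convergence against test functions. -/
lemma exists_collisionDist_lt_imp (he₀ : 0 ≤ e) (he : e < 1) {φ : ℝ → ℝ} (hφ : ContDiff ℝ 1 φ)
    (hφc : HasCompactSupport φ) {μ : ProbabilityMeasure ℝ} (hμ : huberMoment μ ≠ ∞) {ε : ℝ}
    (hε : 0 < ε) : ∃ ρ : ℝ, 0 < ρ ∧ ∀ ν : ProbabilityMeasure ℝ,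
      (collisionDist e μ ν < ENNReal.ofReal ρ ∨ collisionDist e ν μ < ENNReal.ofReal ρ) →
      |∫ v, φ v ∂(ν : Measure ℝ) - ∫ v, φ v ∂(μ : Measure ℝ)| ≤ ε := by
  obtain ⟨L, hL⟩ := (hφ.continuous_deriv le_rfl).bounded_above_of_compact_support hφc.deriv
  have hL0 : 0 ≤ L := (norm_nonneg _).trans (hL 0)
  obtain ⟨C, hC, hb⟩ := exists_fluxMass_le
  set M := (huberMoment μ).toReal with hM
  have hM0 : 0 ≤ M := ENNReal.toReal_nonneg
  -- First `δ` makes the moment term at most `ε/2`, then the action threshold `c`, chosen after `δ`,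
  -- does the same for the action term. The added ones keep the denominators positive.
  obtain ⟨δ, hδ, hδC, hδM⟩ : ∃ δ : ℝ, 0 < δ ∧ δ * C ≤ 1 / 2 ∧ 4 * L * (δ * (M + 1)) ≤ ε / 2 := by
    refine ⟨min (1 / (2 * (C + 1))) (ε / (8 * (L + 1) * (M + 1))), by positivity, ?_, ?_⟩
    · calc _ ≤ 1 / (2 * (C + 1)) * C := by gcongr; exact min_le_left _ _
        _ ≤ 1 / (2 * (C + 1)) * (C + 1) := by gcongr; linarith
        _ = 1 / 2 := by field_simp
    · calc _ ≤ 4 * (L + 1) * (ε / (8 * (L + 1) * (M + 1)) * (M + 1)) := by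
            gcongr
            · linarith
            · exact min_le_right _ _
        _ = ε / 2 := by field_simp; norm_num
  obtain ⟨c, hc, hcε⟩ : ∃ c : ℝ, 0 < c ∧ 4 * L * (1 / (4 * δ) * c) ≤ ε / 2 := by
    refine ⟨ε * δ / (2 * (L + 1)), by positivity, ?_⟩
    calc _ ≤ 4 * (L + 1) * (1 / (4 * δ) * (ε * δ / (2 * (L + 1)))) := by gcongr; linarith
      _ = ε / 2 := by field_simp
  -- The times `a` and `b` are arbitrary, so `μ` may be the initial or the final point and symmetry
  -- of the cost is not needed.
  have main : ∀ (f : ℝ → ProbabilityMeasure ℝ) (U : ℝ → SignedMeasure OffDiag), IsGCE e 1 f U →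
      ContinuousOn f (Icc 0 1) → ∀ a ∈ Icc (0 : ℝ) 1, ∀ b ∈ Icc (0 : ℝ) 1, f a = μ →
      ∫⁻ t in Icc (0 : ℝ) 1, action e (f t) (U t) ≤ ENNReal.ofReal c →
      |∫ v, φ v ∂(f b : Measure ℝ) - ∫ v, φ v ∂(μ : Measure ℝ)| ≤ ε := by
    intro f U h hf a ha b hb' hfa hA
    have h1 := h.ofReal_abs_sub_le he hf hφ hφc hL ha hb'
    have h2 := hb e f U he₀ he h hf a ha δ hδ hδC
    rw [hfa] at h1 h2
    rw [← ENNReal.ofReal_le_ofReal_iff hε.le]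
    refine h1.trans ?_
    calc _ ≤ ENNReal.ofReal (2 * L) * (2 * (ENNReal.ofReal δ * (huberMoment μ + 1)
            + ENNReal.ofReal (1 / (4 * δ)) * ENNReal.ofReal c)) := by
          gcongr
          exact h2.trans (by gcongr)
      _ = ENNReal.ofReal (4 * L * (δ * (M + 1)) + 4 * L * (1 / (4 * δ) * c)) := by
          rw [← ENNReal.ofReal_toReal hμ, ← hM, ← ENNReal.ofReal_one,
            ← ENNReal.ofReal_add hM0 zero_le_one, ← ENNReal.ofReal_mul (by positivity),
            ← ENNReal.ofReal_mul (by positivity),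
            ← ENNReal.ofReal_add (by positivity) (by positivity),
            show (2 : ℝ≥0∞) = ENNReal.ofReal 2 by simp, ← ENNReal.ofReal_mul (by positivity),
            ← ENNReal.ofReal_mul (by positivity)]
          congr 1; ring
      _ ≤ ENNReal.ofReal ε := ENNReal.ofReal_le_ofReal (by linarith)
  have hlt : ∀ μ₀ μ₁ : ProbabilityMeasure ℝ,
      collisionDist e μ₀ μ₁ < ENNReal.ofReal (√c) →
      ∃ f U, (IsGCE e 1 f U ∧ ContinuousOn f (Icc 0 1) ∧ f 0 = μ₀ ∧ f 1 = μ₁) ∧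
        ∫⁻ t in Icc (0 : ℝ) 1, action e (f t) (U t) ≤ ENNReal.ofReal c := by
    intro μ₀ μ₁ hd
    rw [collisionDist, Real.sqrt_eq_rpow, ← ENNReal.ofReal_rpow_of_nonneg hc.le (by norm_num),
      ENNReal.rpow_lt_rpow_iff (by norm_num)] at hd
    simp only [iInf_lt_iff] at hd
    obtain ⟨f, U, h, hlt⟩ := hd
    exact ⟨f, U, h, hlt.le⟩
  refine ⟨√c, Real.sqrt_pos.2 hc, fun ν hν => ?_⟩
  rcases hν with hν | hν
  · obtain ⟨f, U, ⟨h, hf, h0, h1⟩, hA⟩ := hlt _ _ hν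
    have := main f U h hf 0 (by simp) 1 (by simp) h0 hA
    rwa [h1] at this
  · obtain ⟨f, U, ⟨h, hf, h0, h1⟩, hA⟩ := hlt _ _ hν
    have := main f U h hf 1 (by simp) 0 (by simp) h1 hA
    rwa [h0] at this

/-- Along an absolutely continuous curve, integrals of test functions are continuous at the
endpoints. -/
lemma IsACCurve.continuousWithinAt (he₀ : 0 ≤ e) (he : e < 1) (hT : 0 < T)
    {f : ℝ → ProbabilityMeasure ℝ} (hf : IsACCurve e T f) {φ : ℝ → ℝ} (hφ : ContDiff ℝ 1 φ)
    (hφc : HasCompactSupport φ) :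
    ContinuousWithinAt (fun t => ∫ v, φ v ∂(f t : Measure ℝ)) (Icc 0 T) 0 ∧
      ContinuousWithinAt (fun t => ∫ v, φ v ∂(f t : Measure ℝ)) (Icc 0 T) T := by
  obtain ⟨hP, m, hm, hd⟩ := hf
  have h0 : (0 : ℝ) ∈ Icc 0 T := left_mem_Icc.2 hT.le
  have h1 : T ∈ Icc 0 T := right_mem_Icc.2 hT.le
  have hmi : IntegrableOn m (uIcc 0 T) := by
    rw [uIcc_of_le hT.le]; exact hm.integrable (by norm_num)
  constructor
  · rw [ContinuousWithinAt, Metric.tendsto_nhds]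
    intro ε hε
    obtain ⟨ρ, hρ, h⟩ := exists_collisionDist_lt_imp he₀ he hφ hφc
      (huberMoment_ne_top (hP 0 h0)) (half_pos hε)
    have hc := intervalIntegral.continuousOn_primitive_interval hmi 0 left_mem_uIcc
    rw [uIcc_of_le hT.le, ContinuousWithinAt, intervalIntegral.integral_same] at hc
    filter_upwards [hc.eventually_lt_const hρ, self_mem_nhdsWithin] with t ht htI
    rw [Real.dist_eq]
    refine (h (f t) (.inl ?_)).trans_lt (half_lt_self hε)
    exact (hd 0 t le_rfl htI.1 htI.2).trans_lt ((ENNReal.ofReal_lt_ofReal_iff hρ).2 ht)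
  · rw [ContinuousWithinAt, Metric.tendsto_nhds]
    intro ε hε
    obtain ⟨ρ, hρ, h⟩ := exists_collisionDist_lt_imp he₀ he hφ hφc
      (huberMoment_ne_top (hP T h1)) (half_pos hε)
    have hc := intervalIntegral.continuousOn_primitive_interval_left hmi T right_mem_uIcc
    rw [uIcc_of_le hT.le, ContinuousWithinAt, intervalIntegral.integral_same] at hc
    filter_upwards [hc.eventually_lt_const hρ, self_mem_nhdsWithin] with t ht htI
    rw [Real.dist_eq]
    refine (h (f t) (.inr ?_)).trans_lt (half_lt_self hε)
    exact (hd t T htI.1 htI.2 le_rfl).trans_lt ((ENNReal.ofReal_lt_ofReal_iff hρ).2 ht)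

end CollisionDistance

/-! ### The chain rule and the energy identity. -/

section ChainRule

open Function Filter Topology

variable {e T : ℝ} {f : ℝ → ProbabilityMeasure ℝ} {U : ℝ → SignedMeasure OffDiag}

/-- Dominated convergence for time integrals of flux integrals. -/
lemma IsGCE.tendsto_integral_flux (h : IsGCE e T f U) {F : ℕ → OffDiag → ℝ} {F' H : OffDiag → ℝ}
    (hF : ∀ n, Measurable (F n)) (hH : Measurable H) (hFH : ∀ n p, |F n p| ≤ H p)
    (hlim : ∀ p, Tendsto (fun n => F n p) atTop (𝓝 (F' p)))
    (hfin : ∫⁻ t in Icc 0 T, ∫⁻ p, ENNReal.ofReal (H p) ∂(U t).variation ≠ ∞) :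
    Tendsto (fun n => ∫ t in Icc 0 T, ∫ᵛ p, F n p ∂<•(U t)) atTop
      (𝓝 (∫ t in Icc 0 T, ∫ᵛ p, F' p ∂<•(U t))) := by
  have hm := h.aemeasurable_lintegral_flux hH.ennreal_ofReal
  refine tendsto_integral_of_dominated_convergence
    (fun t => (∫⁻ p, ENNReal.ofReal (H p) ∂(U t).variation).toReal) (fun n => ?_)
    (integrable_toReal_of_lintegral_ne_top hm hfin) (fun n => ?_) ?_
  · exact (h.aemeasurable_integral_flux (F := fun _ p => F n p)
      ((hF n).comp measurable_snd)).aestronglyMeasurable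
  · filter_upwards [ae_lt_top' hm hfin] with t ht
    have := enorm_integral_flux_le (U t) (hFH n)
    rw [← toReal_enorm]
    exact ENNReal.toReal_mono ht.ne this
  · filter_upwards [h.ae_integrable hH hfin] with t ht
    exact VectorMeasure.tendsto_integral_of_dominated_convergence H
      (fun n => (hF n).aestronglyMeasurable)
      (ht H hH fun p => (abs_of_nonneg ((abs_nonneg _).trans (hFH 0 p))).le)
      (fun n => .of_forall (hFH n)) (.of_forall hlim)

lemma integrable_of_abs_deriv_le {μ : ProbabilityMeasure ℝ} (hμ : μ ∈ P2cm) {φ : ℝ → ℝ}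
    (hφ : ContDiff ℝ 1 φ) {L : ℝ} (hL : ∀ v, |deriv φ v| ≤ L) :
    Integrable φ (μ : Measure ℝ) := by
  have hL0 : 0 ≤ L := (abs_nonneg _).trans (hL 0)
  refine ((hμ.1.const_mul L).add (integrable_const (|φ 0| + L))).mono'
    hφ.continuous.aestronglyMeasurable (.of_forall fun v => ?_)
  have := Convex.norm_image_sub_le_of_norm_deriv_le (f := φ) (C := L) (s := univ) (x := 0) (y := v)
    (fun x _ => hφ.differentiable one_ne_zero x) (fun x _ => hL x) convex_univ trivial trivial
  rw [Real.norm_eq_abs, Real.norm_eq_abs, sub_zero] at this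
  have h2 : |v| ≤ v ^ 2 + 1 := by rw [abs_le]; constructor <;> nlinarith
  have h3 := mul_le_mul_of_nonneg_left h2 hL0
  have h4 := abs_sub_abs_le_abs_sub (φ v) (φ 0)
  simp only [Pi.add_apply, Real.norm_eq_abs]
  linarith

/-- The weak formulation on all of `[0, T]` against Lipschitz test functions of the velocity. -/
lemma IsGCE.sub_eq_integral_of_isACCurve (he₀ : 0 ≤ e) (he : e < 1) (hT : 0 < T)
    (h : IsGCE e T f U) (hf : IsACCurve e T f) {φ : ℝ → ℝ} (hφ : ContDiff ℝ 1 φ) {L : ℝ}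
    (hL : ∀ v, |deriv φ v| ≤ L) :
    ∫ v, φ v ∂(f T : Measure ℝ) - ∫ v, φ v ∂(f 0 : Measure ℝ)
      = ∫ t in Icc 0 T, ∫ᵛ p, sigma e p * nlGrad φ p ∂<•(U t) := by
  obtain ⟨ψ, C, hψ, hψc, hψC, hψle, -, hψt⟩ := exists_cutoff hφ hL
  have hC : 0 ≤ C := (abs_nonneg _).trans (hψC 0 0)
  have hlim : ∀ t ∈ Icc 0 T, Tendsto (fun n => ∫ v, ψ n v ∂(f t : Measure ℝ)) atTop
      (𝓝 (∫ v, φ v ∂(f t : Measure ℝ))) := fun t ht =>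
    tendsto_integral_of_dominated_convergence (fun v => |φ v|)
      (fun n => (hψ n).continuous.aestronglyMeasurable)
      (integrable_of_abs_deriv_le (hf.1 t ht) hφ hL).abs (fun n => .of_forall (hψle n))
      (.of_forall fun v => tendsto_const_nhds.congr' <| by
        filter_upwards [hψt v] with n hn using hn.self_of_nhds.symm)
  refine tendsto_nhds_unique ((hlim T (right_mem_Icc.2 hT.le)).sub
    (hlim 0 (left_mem_Icc.2 hT.le))) ?_
  have e1 : ∀ n, ∫ v, ψ n v ∂(f T : Measure ℝ) - ∫ v, ψ n v ∂(f 0 : Measure ℝ)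
      = ∫ t in Icc 0 T, ∫ᵛ p, sigma e p * nlGrad (ψ n) p ∂<•(U t) := fun n => by
    obtain ⟨h0, h1⟩ := hf.continuousWithinAt he₀ he hT (hψ n) (hψc n)
    exact h.sub_eq_setIntegral he (hψ n) (hψc n) le_rfl hT le_rfl h0 h1
  simp_rw [e1]
  -- The uniform slope bound of the cutoffs gives the dominating function `2 C σ`, which the flux
  -- integrates.
  refine h.tendsto_integral_flux (fun n => measurable_sigma_mul_nlGrad (hψ n))
    ((measurable_sigma e).const_mul (2 * C)) (fun n => abs_sigma_mul_nlGrad_le he (hψC n))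
    (fun p => ?_) ?_
  · refine tendsto_const_nhds.congr' ?_
    filter_upwards [hψt p.1.1, hψt p.1.2] with n h1 h2
    rw [nlGrad, nlGrad, h1.deriv_eq, h2.deriv_eq]
  · rw [lintegral_const_mul_sigma (by positivity)]
    exact ENNReal.mul_ne_top ENNReal.ofReal_ne_top h.integrability.ne

lemma tendsto_integral_huber {μ : ProbabilityMeasure ℝ} (hμ : μ ∈ P2cm) :
    Tendsto (fun n : ℕ => ∫ v, huber n v ∂(μ : Measure ℝ)) atTop (𝓝 (kineticEnergy μ)) := by
  rw [kineticEnergy, ← integral_const_mul]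
  refine tendsto_integral_of_dominated_convergence (fun v => 1 / 2 * v ^ 2)
    (fun n => (contDiff_huber n.cast_nonneg).continuous.aestronglyMeasurable) (hμ.1.const_mul _)
    (fun n => .of_forall fun v => ?_) (.of_forall fun v => ?_)
  · rw [Real.norm_eq_abs, abs_of_nonneg (huber_nonneg n.cast_nonneg v)]
    exact (huber_le v).trans (by linarith)
  · refine tendsto_const_nhds.congr' ?_
    filter_upwards [eventually_ge_atTop ⌈|v|⌉₊] with n hn
    rw [huber_eq ((Nat.le_ceil _).trans (by exact_mod_cast hn))]; ring

lemma eventually_nlGrad_huber_eq (p : OffDiag) :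
    ∀ᶠ n : ℕ in atTop, nlGrad (huber n) p = -relVel p := by
  filter_upwards [eventually_ge_atTop ⌈|p.1.1|⌉₊, eventually_ge_atTop ⌈|p.1.2|⌉₊] with n h1 h2
  rw [nlGrad, deriv_huber_eq ((Nat.le_ceil _).trans (by exact_mod_cast h2)),
    deriv_huber_eq ((Nat.le_ceil _).trans (by exact_mod_cast h1)), relVel]
  ring

lemma abs_sigma_mul_nlGrad_huber_le (he : e < 1) (n : ℕ) (p : OffDiag) :
    |sigma e p * nlGrad (huber n) p| ≤ sigma e p * |relVel p| := by
  rw [abs_mul, abs_of_nonneg (sigma_nonneg he p)]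
  refine mul_le_mul_of_nonneg_left ?_ (sigma_nonneg he p)
  rw [nlGrad, abs_sub_comm]
  exact abs_deriv_huber_sub_le n.cast_nonneg _ _

/-- The chain rule for the kinetic energy. -/
lemma IsGCE.kineticEnergy_sub_eq (he₀ : 0 ≤ e) (he : e < 1) (hT : 0 < T)
    (h : IsGCE e T f U) (hf : IsACCurve e T f)
    (hfin : ∫⁻ t in Icc 0 T, ∫⁻ p, ENNReal.ofReal (sigma e p * |relVel p|) ∂(U t).variation ≠ ∞) :
    kineticEnergy (f T) - kineticEnergy (f 0)
      = -∫ t in Icc 0 T, ∫ᵛ p, sigma e p * relVel p ∂<•(U t) := by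
  have h1 := (tendsto_integral_huber (hf.1 T (right_mem_Icc.2 hT.le))).sub
    (tendsto_integral_huber (hf.1 0 (left_mem_Icc.2 hT.le)))
  refine tendsto_nhds_unique h1 ?_
  have e1 : ∀ n : ℕ, _ := fun n : ℕ => h.sub_eq_integral_of_isACCurve he₀ he hT hf
    (contDiff_huber n.cast_nonneg) (abs_deriv_huber_le n.cast_nonneg)
  simp_rw [e1]
  have e2 : -∫ t in Icc 0 T, ∫ᵛ p, sigma e p * relVel p ∂<•(U t)
      = ∫ t in Icc 0 T, ∫ᵛ p, -(sigma e p * relVel p) ∂<•(U t) := by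
    rw [← integral_neg]
    refine integral_congr_ae (.of_forall fun t => ?_)
    exact (VectorMeasure.integral_fun_neg _ _ _).symm
  rw [e2]
  refine h.tendsto_integral_flux
    (fun n => measurable_sigma_mul_nlGrad (contDiff_huber n.cast_nonneg))
    ((measurable_sigma e).mul measurable_relVel.abs) (abs_sigma_mul_nlGrad_huber_le he)
    (fun p => ?_) hfin
  refine tendsto_const_nhds.congr' ?_
  filter_upwards [eventually_nlGrad_huber_eq p] with n hn
  rw [hn, mul_neg]

/-- Young's inequality with `δ = 1`. It supplies the integrability hypothesis of the chain rule. -/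
lemma IsGCE.lintegral_relVel_flux_le (he : e < 1) (h : IsGCE e T f U) :
    ∫⁻ t in Icc 0 T, ∫⁻ p, ENNReal.ofReal (sigma e p * |relVel p|) ∂(U t).variation
      ≤ (∫⁻ t in Icc 0 T, dissipation e (f t)) + ∫⁻ t in Icc 0 T, action e (f t) (U t) := by
  have hm : Measurable fun p => ENNReal.ofReal (sigma e p) * ENNReal.ofReal (relVel p ^ 2) :=
    (measurable_sigma e).ennreal_ofReal.mul (measurable_relVel.pow_const 2).ennreal_ofReal
  simp_rw [dissipation_eq]
  rw [← lintegral_add_left' (h.aemeasurable_lintegral_prodOff hm)]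
  refine lintegral_mono fun t => ?_
  have := lintegral_variation_le_relAction (prodOff (f t)) (U t) (measurable_sigma e)
    measurable_relVel one_pos
  rw [← action_eq_relAction, ENNReal.ofReal_one, one_mul] at this
  refine le_trans (le_of_eq (lintegral_congr fun p => ?_)) (this.trans ?_)
  · rw [ENNReal.ofReal_mul (sigma_nonneg he p), ← ofReal_norm, Real.norm_eq_abs]
  · refine add_le_add le_rfl (mul_le_of_le_one_left' ?_)
    rw [ENNReal.ofReal_le_one]; norm_num

/-- The excess action `∫₀ᵀ ∬ |u_t - (v - v⋆)|² σ_e d(f_t ⊗ f_t) dt` of the flux `u_t d(f_t ⊗ f_t)`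
over the flux driven by the energy. -/
def excessAction (e T : ℝ) (f : ℝ → ProbabilityMeasure ℝ) (U : ℝ → SignedMeasure OffDiag) :
    ℝ≥0∞ :=
  ∫⁻ t in Icc 0 T, relAction (sigma e) relVel (prodOff (f t)) (U t)

/-- The energy identity. -/
lemma IsGCE.action_add_dissipation_eq (he₀ : 0 ≤ e) (he : e < 1) (hT : 0 < T)
    (h : IsGCE e T f U) (hf : IsACCurve e T f)
    (hD : ∫⁻ t in Icc 0 T, dissipation e (f t) ≠ ∞)
    (hA : ∫⁻ t in Icc 0 T, action e (f t) (U t) ≠ ∞) :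
    excessAction e T f U ≠ ∞ ∧
      (∫⁻ t in Icc 0 T, action e (f t) (U t)).toReal
        + (∫⁻ t in Icc 0 T, dissipation e (f t)).toReal
        + 2 * (kineticEnergy (f T) - kineticEnergy (f 0)) = (excessAction e T f U).toReal := by
  have hfin := ne_top_of_le_ne_top (ENNReal.add_ne_top.2 ⟨hD, hA⟩) (h.lintegral_relVel_flux_le he)
  rw [h.kineticEnergy_sub_eq he₀ he hT hf hfin]
  have hm : Measurable fun p => ENNReal.ofReal (sigma e p) * ENNReal.ofReal (relVel p ^ 2) :=
    (measurable_sigma e).ennreal_ofReal.mul (measurable_relVel.pow_const 2).ennreal_ofReal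
  have hDm : AEMeasurable (fun t => dissipation e (f t)) (volume.restrict (Icc 0 T)) := by
    simp_rw [dissipation_eq]; exact h.aemeasurable_lintegral_prodOff hm
  set P : ℝ → ℝ := fun t => ∫ᵛ p, sigma e p * relVel p ∂<•(U t) with hP
  have hPi : Integrable P (volume.restrict (Icc 0 T)) :=
    h.integrable_integral_flux (F := fun _ p => sigma e p * relVel p)
      (((measurable_sigma e).mul measurable_relVel).comp measurable_snd)
      (fun _ p => by rw [abs_mul, abs_of_nonneg (sigma_nonneg he p)]) hfin
  have hPm : AEMeasurable P (volume.restrict (Icc 0 T)) := hPi.aestronglyMeasurable.aemeasurable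
  have hP2 : Integrable (fun t => 2 * P t) (volume.restrict (Icc 0 T)) := hPi.const_mul 2
  have hn : AEMeasurable (fun t => ENNReal.ofReal (2 * -P t)) (volume.restrict (Icc 0 T)) :=
    (hPm.neg.const_mul 2).ennreal_ofReal
  -- The square is completed at almost every time, without subtraction; finiteness of the other
  -- terms then yields that of the excess, and only afterwards does the identity become one of
  -- reals.
  have key : (∫⁻ t in Icc 0 T, action e (f t) (U t)) + (∫⁻ t in Icc 0 T, dissipation e (f t))
      + ∫⁻ t in Icc 0 T, ENNReal.ofReal (2 * -P t)
      = excessAction e T f U + ∫⁻ t in Icc 0 T, ENNReal.ofReal (2 * P t) := by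
    rw [excessAction, ← lintegral_add_right' _ hDm,
      ← lintegral_add_right' _ hn,
      ← lintegral_add_right' _ (hPm.const_mul 2).ennreal_ofReal]
    refine lintegral_congr_ae ?_
    filter_upwards [ae_lt_top' hDm hD] with t ht
    rw [dissipation_eq] at ht ⊢
    rw [action_eq_relAction]
    exact relAction_zero_add_eq (prodOff (f t)) (U t) (measurable_sigma e) (sigma_nonneg he)
      measurable_relVel ht.ne
  have f1 : ∫⁻ t in Icc 0 T, ENNReal.ofReal (2 * P t) ≠ ∞ := (Integrable.lintegral_lt_top hP2).ne
  have f2 : ∫⁻ t in Icc 0 T, ENNReal.ofReal (2 * -P t) ≠ ∞ := by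
    simp only [mul_neg]
    exact (Integrable.lintegral_lt_top hP2.neg).ne
  have hPe : 2 * ∫ t in Icc 0 T, P t = (∫⁻ t in Icc 0 T, ENNReal.ofReal (2 * P t)).toReal
      - (∫⁻ t in Icc 0 T, ENNReal.ofReal (2 * -P t)).toReal := by
    rw [← integral_const_mul, integral_eq_lintegral_pos_part_sub_lintegral_neg_part hP2]
    simp only [mul_neg]
  have hR : excessAction e T f U ≠ ∞ := by
    intro hR
    rw [hR, top_add] at key
    exact absurd key (by finiteness)
  refine ⟨hR, ?_⟩
  have key' := congrArg ENNReal.toReal key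
  rw [ENNReal.toReal_add (by finiteness) f2, ENNReal.toReal_add hR f1,
    ENNReal.toReal_add hA hD] at key'
  linarith

end ChainRule

/-! ### Weak solutions have zero De Giorgi functional. -/

section WeakSolutions

open Function Filter Topology

variable {e T : ℝ} {f : ℝ → ProbabilityMeasure ℝ} {U : ℝ → SignedMeasure OffDiag}

lemma integral_energyFlux {μ : ProbabilityMeasure ℝ} (hμ : μ ∈ P2cm) (h : OffDiag → ℝ) :
    ∫ᵛ p, h p ∂<•(energyFlux μ) = ∫ p, h p * relVel p ∂(prodOff μ) := by
  rw [energyFlux_eq, integral_withDensityᵥ (integrable_relVel hμ)]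

lemma integrable_sigma_mul_mul_relVel {μ : ProbabilityMeasure ℝ} (hμ : μ ∈ P2cm)
    {h : OffDiag → ℝ} (hh : Measurable h) {C : ℝ} (hC : ∀ p, |h p| ≤ C) :
    Integrable (fun p => sigma e p * h p * relVel p) (prodOff μ) := by
  refine ((integrable_sigma_mul_relVel (e := e) hμ).abs.const_mul C).mono'
    (((measurable_sigma e).mul hh).mul measurable_relVel).aestronglyMeasurable
    (.of_forall fun p => ?_)
  rw [mul_right_comm, Real.norm_eq_abs, abs_mul, mul_comm]
  exact mul_le_mul_of_nonneg_right (hC p) (abs_nonneg _)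

lemma sigma_mul_nlGrad_huber_mul_nonpos (he : e < 1) (n : ℕ) (p : OffDiag) :
    sigma e p * nlGrad (huber n) p * relVel p ≤ 0 := by
  have := mul_nonneg (sigma_nonneg he p)
    (deriv_huber_sub_mul_nonneg n.cast_nonneg p.1.1 p.1.2)
  rw [nlGrad, relVel]; linarith

/-- Weak solutions have finite dissipation. -/
lemma IsWeakSolution.lintegral_dissipation_ne_top (he₀ : 0 ≤ e) (he : e < 1) (hT : 0 < T)
    (h : IsWeakSolution e T f) (hf : IsACCurve e T f) :
    ∫⁻ t in Icc 0 T, dissipation e (f t) ≠ ∞ := by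
  set V : ℝ → SignedMeasure OffDiag := fun t => energyFlux (f t) with hV
  have hG : IsGCE e T f V := h.2
  set G : ℕ → ℝ → ℝ := fun n t => ∫ᵛ p, sigma e p * nlGrad (huber n) p ∂<•(V t) with hGdef
  -- `K n` is the dissipation density of the truncated energy: nonnegative, and eventually equal to
  -- `σ |v - v⋆|²` at each point.
  set K : ℕ → OffDiag → ℝ := fun n p => -(sigma e p * nlGrad (huber n) p * relVel p) with hK
  have hKm : ∀ n, Measurable (K n) := fun n =>
    ((measurable_sigma_mul_nlGrad (contDiff_huber n.cast_nonneg)).mul measurable_relVel).neg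
  have hK0 : ∀ n p, 0 ≤ K n p := fun n p =>
    neg_nonneg.2 (sigma_mul_nlGrad_huber_mul_nonpos he n p)
  have hGK : ∀ n, ∀ t ∈ Icc 0 T, G n t = -∫ p, K n p ∂(prodOff (f t)) := fun n t ht => by
    simp only [hGdef, hK, hV]
    rw [integral_energyFlux (h.1 t ht), integral_neg, neg_neg]
  have hKi : ∀ n, ∀ t ∈ Icc 0 T,
      ∫⁻ p, ENNReal.ofReal (K n p) ∂(prodOff (f t)) = ENNReal.ofReal (-G n t) := fun n t ht => by
    rw [hGK n t ht, neg_neg, ofReal_integral_eq_lintegral_ofReal _ (.of_forall (hK0 n))]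
    exact (integrable_sigma_mul_mul_relVel (h.1 t ht)
      (continuous_nlGrad (contDiff_huber n.cast_nonneg)).measurable
      (abs_nlGrad_le (abs_deriv_huber_le n.cast_nonneg))).neg
  have hG0 : ∀ n, ∀ t ∈ Icc 0 T, 0 ≤ -G n t := fun n t ht => by
    rw [hGK n t ht, neg_neg]; exact integral_nonneg (hK0 n)
  have hGi : ∀ n, IntegrableOn (G n) (Icc 0 T) := fun n =>
    hG.integrable_integral_flux (F := fun _ p => sigma e p * nlGrad (huber n) p)
      (H := fun p => 2 * n * sigma e p)
      ((measurable_sigma_mul_nlGrad (contDiff_huber n.cast_nonneg)).comp measurable_snd)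
      (fun _ => abs_sigma_mul_nlGrad_le he (abs_deriv_huber_le n.cast_nonneg)) (by
        rw [lintegral_const_mul_sigma (by positivity)]
        exact ENNReal.mul_ne_top ENNReal.ofReal_ne_top hG.integrability.ne)
  have hGn : ∀ n, Integrable (fun t => -G n t) (volume.restrict (Icc 0 T)) := fun n => (hGi n).neg
  -- The total truncated dissipation is the loss of truncated energy, which is at most its initial
  -- value and hence at most `E(f_0)`.
  have hbound : ∀ n, ∫⁻ t in Icc 0 T, ∫⁻ p, ENNReal.ofReal (K n p) ∂(prodOff (f t))
      ≤ ENNReal.ofReal (kineticEnergy (f 0)) := fun n => by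
    rw [setLIntegral_congr_fun measurableSet_Icc (hKi n),
      ← ofReal_integral_eq_lintegral_ofReal (hGn n)
        (by filter_upwards [ae_restrict_mem measurableSet_Icc] with t ht using hG0 n t ht),
      integral_neg, ← hG.sub_eq_integral_of_isACCurve he₀ he hT hf (contDiff_huber n.cast_nonneg)
        (abs_deriv_huber_le n.cast_nonneg)]
    refine ENNReal.ofReal_le_ofReal ?_
    have h1 : 0 ≤ ∫ v, huber n v ∂(f T : Measure ℝ) :=
      integral_nonneg (huber_nonneg n.cast_nonneg)
    have h0 := hf.1 0 (left_mem_Icc.2 hT.le)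
    have h2 : ∫ v, huber n v ∂(f 0 : Measure ℝ) ≤ kineticEnergy (f 0) := by
      rw [kineticEnergy, ← integral_const_mul]
      exact integral_mono (integrable_of_abs_deriv_le h0 (contDiff_huber n.cast_nonneg)
        (abs_deriv_huber_le n.cast_nonneg)) (h0.1.const_mul _)
        fun v => (huber_le v).trans (by linarith)
    linarith
  refine ne_top_of_le_ne_top (ENNReal.ofReal_ne_top (r := kineticEnergy (f 0))) ?_
  -- Fatou's lemma is applied twice, in the velocities and then in time.
  calc ∫⁻ t in Icc 0 T, dissipation e (f t)
      ≤ ∫⁻ t in Icc 0 T, liminf (fun n => ∫⁻ p, ENNReal.ofReal (K n p) ∂(prodOff (f t)))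
          atTop := by
        refine lintegral_mono fun t => ?_
        rw [dissipation_eq]
        refine le_trans (le_of_eq (lintegral_congr fun p => ?_))
          (lintegral_liminf_le fun n => (hKm n).ennreal_ofReal)
        refine (Tendsto.liminf_eq (tendsto_const_nhds.congr' ?_)).symm
        filter_upwards [eventually_nlGrad_huber_eq p] with n hn
        rw [← ENNReal.ofReal_mul (sigma_nonneg he p), hK]
        simp only
        rw [hn]; congr 1; ring
    _ ≤ liminf (fun n => ∫⁻ t in Icc 0 T, ∫⁻ p, ENNReal.ofReal (K n p) ∂(prodOff (f t)))
          atTop :=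
        lintegral_liminf_le' fun n => hG.aemeasurable_lintegral_prodOff (hKm n).ennreal_ofReal
    _ ≤ ENNReal.ofReal (kineticEnergy (f 0)) :=
        liminf_le_of_le (by isBoundedDefault) fun b hb => by
          obtain ⟨n, hn⟩ := hb.exists
          exact hn.trans (hbound n)

lemma action_energyFlux_le {μ : ProbabilityMeasure ℝ} (hμ : μ ∈ P2cm) :
    action e μ (energyFlux μ) ≤ dissipation e μ := by
  rw [action_eq_relAction, dissipation_eq, energyFlux_eq]
  exact relAction_withDensityᵥ_le _ (measurable_sigma e) measurable_relVel (integrable_relVel hμ)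

/-- The energy balance of weak solutions. -/
lemma IsWeakSolution.kineticEnergy_sub_eq (he₀ : 0 ≤ e) (he : e < 1) (hT : 0 < T)
    (h : IsWeakSolution e T f) (hf : IsACCurve e T f) :
    kineticEnergy (f T) - kineticEnergy (f 0)
      = -(∫⁻ t in Icc 0 T, dissipation e (f t)).toReal := by
  have hD := h.lintegral_dissipation_ne_top he₀ he hT hf
  have hA : ∫⁻ t in Icc 0 T, action e (f t) (energyFlux (f t)) ≠ ∞ :=
    ne_top_of_le_ne_top hD (setLIntegral_mono' measurableSet_Icc fun t ht =>
      action_energyFlux_le (h.1 t ht))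
  have hm : Measurable fun p => ENNReal.ofReal (sigma e p) * ENNReal.ofReal (relVel p ^ 2) :=
    (measurable_sigma e).ennreal_ofReal.mul (measurable_relVel.pow_const 2).ennreal_ofReal
  have hDm : AEMeasurable (fun t => dissipation e (f t)) (volume.restrict (Icc 0 T)) := by
    simp_rw [dissipation_eq]; exact h.2.aemeasurable_lintegral_prodOff hm
  rw [h.2.kineticEnergy_sub_eq he₀ he hT hf (ne_top_of_le_ne_top (ENNReal.add_ne_top.2 ⟨hD, hA⟩)
    (h.2.lintegral_relVel_flux_le he)), ← integral_toReal hDm (ae_lt_top' hDm hD)]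
  congr 1
  refine setIntegral_congr_fun measurableSet_Icc fun t ht => ?_
  have hms : Measurable fun p => sigma e p * relVel p * relVel p :=
    ((measurable_sigma e).mul measurable_relVel).mul measurable_relVel
  rw [integral_energyFlux (h.1 t ht), dissipation_eq, integral_eq_lintegral_of_nonneg_ae
    (.of_forall fun p => ?_) hms.aestronglyMeasurable]
  · congr 1
    refine lintegral_congr fun p => ?_
    rw [← ENNReal.ofReal_mul (sigma_nonneg he p)]; congr 1; ring
  · rw [mul_assoc]
    exact mul_nonneg (sigma_nonneg he p) (mul_self_nonneg _)

/-- An infinite action or dissipation makes the functional `∞`, so vanishing forces both to be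
finite. The rest is the doubled equation in `ℝ`. -/
lemma deGiorgi_eq_zero_iff :
    deGiorgi e T f = 0 ↔ curveAction e T f ≠ ∞ ∧ ∫⁻ t in Icc 0 T, dissipation e (f t) ≠ ∞ ∧
      (curveAction e T f).toReal + (∫⁻ t in Icc 0 T, dissipation e (f t)).toReal
        + 2 * (kineticEnergy (f T) - kineticEnergy (f 0)) = 0 := by
  rw [deGiorgi]
  generalize curveAction e T f = a
  generalize ∫⁻ t in Icc 0 T, dissipation e (f t) = d
  generalize kineticEnergy (f T) - kineticEnergy (f 0) = x
  by_cases ha : a = ∞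
  · simp [ha, ENNReal.top_div]
  by_cases hd : d = ∞
  · simp [hd, ENNReal.top_div]
  lift a to NNReal using ha
  lift d to NNReal using hd
  have e1 : ((a : ℝ≥0∞) / 2 + (d : ℝ≥0∞) / 2) = (((a / 2 + d / 2 : NNReal)) : ℝ≥0∞) := by
    push_cast; rfl
  rw [e1, EReal.coe_nnreal_eq_coe_real, ← EReal.coe_add, EReal.coe_eq_zero]
  simp only [ne_eq, ENNReal.coe_ne_top, not_false_eq_true, true_and, ENNReal.coe_toReal,
    NNReal.coe_add, NNReal.coe_div, NNReal.coe_ofNat]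
  constructor <;> intro h <;> linarith

lemma IsWeakSolution.deGiorgi_eq_zero (he₀ : 0 ≤ e) (he : e < 1) (hT : 0 < T)
    (h : IsWeakSolution e T f) (hf : IsACCurve e T f) : deGiorgi e T f = 0 := by
  have hD := h.lintegral_dissipation_ne_top he₀ he hT hf
  have hE := h.kineticEnergy_sub_eq he₀ he hT hf
  have h1 : curveAction e T f ≤ ∫⁻ t in Icc 0 T, dissipation e (f t) :=
    (iInf₂_le _ h.2).trans (setLIntegral_mono' measurableSet_Icc fun t ht =>
      action_energyFlux_le (h.1 t ht))
  -- Since the energy drops by exactly `∫ D`, the energy identity for any competitor `U` reads `∫ A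
  -- - ∫ D = excess ≥ 0`.
  have h2 : ∫⁻ t in Icc 0 T, dissipation e (f t) ≤ curveAction e T f := by
    refine le_iInf₂ fun U hU => ?_
    by_cases hA : ∫⁻ t in Icc 0 T, action e (f t) (U t) = ∞
    · rw [hA]; exact le_top
    have := (hU.action_add_dissipation_eq he₀ he hT hf hD hA).2
    have h0 : 0 ≤ (excessAction e T f U).toReal := ENNReal.toReal_nonneg
    rw [← ENNReal.toReal_le_toReal hD hA]
    linarith
  rw [deGiorgi_eq_zero_iff, le_antisymm h1 h2, hE]
  exact ⟨hD, hD, by ring⟩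

end WeakSolutions

/-! ### Curves with zero De Giorgi functional are weak solutions. -/

section Minimizers

open Function Filter Topology

variable {e T : ℝ} {f : ℝ → ProbabilityMeasure ℝ} {U : ℝ → SignedMeasure OffDiag}

/-- Pointwise, `r ≤ 1 + r³` and `(1 - e)/4 ≤ 1`. -/
lemma lintegral_sigma_prodOff_le_dissipation (he₀ : 0 ≤ e) (he : e < 1) (μ : ProbabilityMeasure ℝ) :
    ∫⁻ p, ENNReal.ofReal (sigma e p) ∂(prodOff μ) ≤ 1 + dissipation e μ := by
  have h1 : ∫⁻ _, 1 ∂(prodOff μ) ≤ 1 := by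
    simpa using lintegral_prodOff_le μ fun _ => 1
  refine le_trans ?_ (add_le_add h1 (dissipation_eq e μ).ge)
  rw [← lintegral_add_left measurable_const]
  refine lintegral_mono fun p => ?_
  rw [← ENNReal.ofReal_mul (sigma_nonneg he p), ← ENNReal.ofReal_one,
    ← ENNReal.ofReal_add zero_le_one (mul_nonneg (sigma_nonneg he p) (sq_nonneg _))]
  refine ENNReal.ofReal_le_ofReal ?_
  rw [sigma, relVel, ← sq_abs]
  set r := |p.1.1 - p.1.2|
  have hr : 0 ≤ r := abs_nonneg _
  have h3 : r ≤ 1 + r ^ 3 := by nlinarith [mul_nonneg hr (sq_nonneg (r - 1)), sq_nonneg (r - 1)]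
  have h4 : 0 ≤ (1 - e) / 4 := by linarith
  nlinarith [mul_le_mul_of_nonneg_left h3 h4]

lemma lintegral_sigma_energyFlux_le (he₀ : 0 ≤ e) (he : e < 1) {μ : ProbabilityMeasure ℝ}
    (hμ : μ ∈ P2cm) :
    ∫⁻ p, ENNReal.ofReal (sigma e p) ∂(energyFlux μ).variation ≤ 1 + 2 * dissipation e μ := by
  have := lintegral_variation_le_relAction (prodOff μ) (energyFlux μ) (measurable_sigma e)
    (h := fun _ => 1) measurable_const one_pos
  rw [← action_eq_relAction] at this
  simp only [enorm_one, mul_one, one_pow, ENNReal.ofReal_one, one_mul] at this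
  refine this.trans ?_
  rw [two_mul, ← add_assoc]
  refine add_le_add (lintegral_sigma_prodOff_le_dissipation he₀ he μ) (mul_le_of_le_one_of_le ?_
    (action_energyFlux_le hμ))
  rw [ENNReal.ofReal_le_one]; norm_num

lemma measurable_energyFlux {α : Type*} [MeasurableSpace α] {c : α → ProbabilityMeasure ℝ}
    (hc : ∀ B : Set ℝ, MeasurableSet B → Measurable fun a => (c a : Measure ℝ) B)
    (h2 : ∀ a, c a ∈ P2cm) {B : Set OffDiag} (hB : MeasurableSet B) :
    Measurable fun a => energyFlux (c a) B := by
  have : (fun a => energyFlux (c a) B) = fun a => ∫ p, B.indicator relVel p ∂(prodOff (c a)) := by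
    ext a
    rw [energyFlux_eq, withDensityᵥ_apply (integrable_relVel (h2 a)) hB, integral_indicator hB]
  rw [this]
  exact measurable_integral_prodOff hc (F := fun _ => B.indicator relVel)
    ((measurable_relVel.indicator hB).comp measurable_snd)

lemma deriv_eq_fderiv {φ : ℝ × ℝ → ℝ} (hφ : ContDiff ℝ 1 φ) (t v : ℝ) :
    deriv (fun w => φ (t, w)) v = fderiv ℝ φ (t, v) (0, 1) := by
  have h1 : HasFDerivAt φ (fderiv ℝ φ (t, v)) (t, v) :=
    (hφ.differentiable one_ne_zero (t, v)).hasFDerivAt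
  have h2 : HasDerivAt (fun w : ℝ => (t, w)) ((0 : ℝ), (1 : ℝ)) v :=
    (hasDerivAt_const v t).prodMk (hasDerivAt_id v)
  exact (h1.comp_hasDerivAt v h2).deriv

lemma measurable_nlGrad_slice {φ : ℝ × ℝ → ℝ} (hφ : ContDiff ℝ 1 φ) :
    Measurable (uncurry fun (t : ℝ) (p : OffDiag) => nlGrad (fun v => φ (t, v)) p) := by
  have h : Continuous fun q => fderiv ℝ φ q (0, 1) :=
    (hφ.continuous_fderiv one_ne_zero).clm_apply continuous_const
  have e1 : (uncurry fun (t : ℝ) (p : OffDiag) => nlGrad (fun v => φ (t, v)) p)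
      = fun q : ℝ × OffDiag => fderiv ℝ φ (q.1, q.2.1.2) (0, 1)
        - fderiv ℝ φ (q.1, q.2.1.1) (0, 1) := by
    ext ⟨t, p⟩
    simp only [uncurry, nlGrad, deriv_eq_fderiv hφ]
  rw [e1]
  exact (h.measurable.comp (by fun_prop)).sub (h.measurable.comp (by fun_prop))

lemma exists_abs_deriv_slice_le {φ : ℝ × ℝ → ℝ} (hφ : ContDiff ℝ 1 φ)
    (hφc : HasCompactSupport φ) : ∃ L : ℝ, ∀ t v, |deriv (fun w => φ (t, w)) v| ≤ L := by
  obtain ⟨L, hL⟩ := (hφ.continuous_fderiv one_ne_zero).bounded_above_of_compact_support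
    (hφc.fderiv ℝ)
  refine ⟨L, fun t v => ?_⟩
  rw [deriv_eq_fderiv hφ, ← Real.norm_eq_abs]
  refine ((fderiv ℝ φ (t, v)).le_opNorm _).trans ?_
  have : ‖((0 : ℝ), (1 : ℝ))‖ = 1 := by simp [Prod.norm_def]
  rw [this, mul_one]
  exact hL _

/-- A curve whose continuity equation is solved by fluxes of arbitrarily small excess action is
driven by the energy. -/
lemma isGCE_energyFlux (he₀ : 0 ≤ e) (he : e < 1)
    (hP : ∀ t ∈ Icc 0 T, f t ∈ P2cm) (hD : ∫⁻ t in Icc 0 T, dissipation e (f t) ≠ ∞)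
    (hU : ∀ c : ℝ≥0∞, c ≠ 0 → ∃ U, IsGCE e T f U ∧ excessAction e T f U ≤ c) :
    IsGCE e T f fun t => energyFlux (f t) := by
  -- `U₀` serves only to provide measurability of the curve.
  obtain ⟨U₀, hU₀, -⟩ := hU 1 one_ne_zero
  have hVm : ∀ B : Set OffDiag, MeasurableSet B →
      Measurable fun t : Icc (0 : ℝ) T => energyFlux (f t) B := fun B hB =>
    measurable_energyFlux (c := fun t : Icc (0 : ℝ) T => f t) hU₀.measurable_curve
      (fun t => hP t t.2) hB
  have hS : ∫⁻ t in Icc 0 T, ∫⁻ p, ENNReal.ofReal (sigma e p) ∂(prodOff (f t)) ≠ ∞ := by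
    refine ne_top_of_le_ne_top ?_ (lintegral_mono fun t =>
      lintegral_sigma_prodOff_le_dissipation he₀ he (f t))
    rw [lintegral_add_left measurable_const]
    simp [hD]
  have hV : fluxMass e T (fun t => energyFlux (f t)) < ∞ := by
    refine (setLIntegral_mono' measurableSet_Icc fun t ht =>
      lintegral_sigma_energyFlux_le he₀ he (hP t ht)).trans_lt ?_
    rw [lintegral_add_left measurable_const, lintegral_const_mul' _ _ (by simp)]
    simp [ENNReal.mul_lt_top, hD.lt_top]
  refine ⟨hU₀.measurable_curve, hVm, hV, fun φ hφ hφc hφs => ?_⟩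
  obtain ⟨L, hL⟩ := exists_abs_deriv_slice_le hφ hφc
  have hL0 : 0 ≤ L := (abs_nonneg _).trans (hL 0 0)
  set H : ℝ → OffDiag → ℝ := fun t => nlGrad (fun v => φ (t, v)) with hH
  have hHm : Measurable (uncurry H) := measurable_nlGrad_slice hφ
  have hHt : ∀ t, Measurable (H t) := fun t => hHm.comp measurable_prodMk_left
  have hHL : ∀ t p, |H t p| ≤ 2 * L := fun t p => abs_nlGrad_le (hL t) p
  have hFm : Measurable (uncurry fun t p => sigma e p * H t p) :=
    ((measurable_sigma e).comp measurable_snd).mul hHm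
  have hFL : ∀ t p, |sigma e p * H t p| ≤ 2 * L * sigma e p := fun t p =>
    abs_sigma_mul_nlGrad_le he (hL t) p
  have hfin : ∀ W : ℝ → SignedMeasure OffDiag, fluxMass e T W < ∞ →
      ∫⁻ t in Icc 0 T, ∫⁻ p, ENNReal.ofReal (2 * L * sigma e p) ∂(W t).variation ≠ ∞ :=
    fun W hW => by
      rw [lintegral_const_mul_sigma (by positivity)]
      exact ENNReal.mul_ne_top ENNReal.ofReal_ne_top hW.ne
  have hVi : IntegrableOn (fun t => ∫ᵛ p, sigma e p * H t p ∂<•(energyFlux (f t))) (Icc 0 T) :=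
    ⟨(aemeasurable_restrict_of_measurable_subtype measurableSet_Icc
      (measurable_integral_signedMeasure hVm
        (measurable_uncurry_subtype hFm))).aestronglyMeasurable,
      (lintegral_mono fun t => enorm_integral_flux_le _ (hFL t)).trans_lt
        (lt_top_iff_ne_top.2 (hfin _ hV))⟩
  set B : ℝ≥0∞ := ENNReal.ofReal ((2 * L) ^ 2)
    * ∫⁻ t in Icc 0 T, ∫⁻ p, ENNReal.ofReal (sigma e p) ∂(prodOff (f t)) with hB
  have hBt : B ≠ ∞ := ENNReal.mul_ne_top ENNReal.ofReal_ne_top hS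
  have key : ∀ U, IsGCE e T f U → ∀ δ : ℝ, 0 < δ →
      ‖(∫ t in Icc 0 T, ∫ᵛ p, sigma e p * H t p ∂<•(U t))
        - ∫ t in Icc 0 T, ∫ᵛ p, sigma e p * H t p ∂<•(energyFlux (f t))‖ₑ
      ≤ ENNReal.ofReal δ * B + ENNReal.ofReal (1 / (4 * δ)) * excessAction e T f U := by
    intro U h δ hδ
    have hUfin := hfin U h.integrability
    rw [← integral_sub (h.integrable_integral_flux hFm hFL hUfin) hVi]
    refine (enorm_integral_le_lintegral_enorm _).trans ?_
    have hSm : AEMeasurable (fun t => ∫⁻ p, ENNReal.ofReal (sigma e p) ∂(prodOff (f t)))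
        (volume.restrict (Icc 0 T)) :=
      h.aemeasurable_lintegral_prodOff (measurable_sigma e).ennreal_ofReal
    rw [hB, excessAction, ← lintegral_const_mul' _ _ ENNReal.ofReal_ne_top,
      ← lintegral_const_mul' _ _ ENNReal.ofReal_ne_top,
      ← lintegral_const_mul' _ _ ENNReal.ofReal_ne_top,
      ← lintegral_add_left' ((hSm.const_mul _).const_mul _)]
    refine lintegral_mono_ae ?_
    filter_upwards [h.ae_integrable ((measurable_sigma e).const_mul (2 * L)) hUfin,
      ae_restrict_mem measurableSet_Icc] with t hit ht
    rw [integral_energyFlux (hP t ht)]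
    refine (enorm_integral_sub_le_relAction (prodOff (f t)) (U t) (measurable_sigma e)
      (sigma_nonneg he) (hHt t) (hit _ ((measurable_sigma e).mul (hHt t)) (hFL t))
      (integrable_sigma_mul_mul_relVel (hP t ht) (hHt t) (hHL t)) hδ).trans ?_
    refine add_le_add (mul_le_mul_right ?_ _) le_rfl
    rw [← lintegral_const_mul' _ _ ENNReal.ofReal_ne_top]
    refine lintegral_mono fun p => ?_
    rw [mul_comm]
    refine mul_le_mul_left (ENNReal.ofReal_le_ofReal ?_) _
    rw [← sq_abs]
    exact pow_le_pow_left₀ (abs_nonneg _) (hHL t p) 2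
  have hlim : ∀ ε : ℝ, 0 < ε → ∃ U, IsGCE e T f U ∧
      |(∫ t in Icc 0 T, ∫ᵛ p, sigma e p * H t p ∂<•(U t))
        - ∫ t in Icc 0 T, ∫ᵛ p, sigma e p * H t p ∂<•(energyFlux (f t))| ≤ ε := by
    intro ε hε
    have hB0 : 0 ≤ B.toReal := ENNReal.toReal_nonneg
    obtain ⟨δ, hδ, hδB⟩ : ∃ δ : ℝ, 0 < δ ∧ δ * B.toReal ≤ ε / 2 :=
      ⟨ε / 2 / (B.toReal + 1), by positivity, by
        rw [div_mul_eq_mul_div, div_le_iff₀ (by positivity)]; nlinarith⟩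
    -- The excess budget `2δε` turns the second error term into `2δε / (4δ) = ε/2`.
    obtain ⟨U, hU, hc⟩ := hU (ENNReal.ofReal (2 * δ * ε)) (by simp; positivity)
    refine ⟨U, hU, ?_⟩
    have h1 := (key U hU δ hδ).trans (add_le_add le_rfl (mul_le_mul_right hc _))
    rw [← ENNReal.ofReal_toReal hBt, ← ENNReal.ofReal_mul hδ.le,
      ← ENNReal.ofReal_mul (by positivity), ← ENNReal.ofReal_add (by positivity) (by positivity),
      ← ofReal_norm, ENNReal.ofReal_le_ofReal_iff (by positivity), Real.norm_eq_abs] at h1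
    refine h1.trans ?_
    have : 1 / (4 * δ) * (2 * δ * ε) = ε / 2 := by field_simp; norm_num
    linarith
  rw [← abs_nonpos_iff]
  refine le_of_forall_pos_le_add fun ε hε => ?_
  obtain ⟨U, hU, hUε⟩ := hlim ε hε
  have hw := hU.weak_form φ hφ hφc hφs
  rw [abs_sub_comm] at hUε
  rw [zero_add]
  refine le_trans (le_of_eq (congrArg _ ?_)) hUε
  rw [hH]
  linarith

lemma isWeakSolution_of_deGiorgi_eq_zero (he₀ : 0 ≤ e) (he : e < 1) (hT : 0 < T)
    (hf : IsACCurve e T f) (h : deGiorgi e T f = 0) : IsWeakSolution e T f := by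
  obtain ⟨hA, hD, hE⟩ := deGiorgi_eq_zero_iff.1 h
  refine ⟨hf.1, isGCE_energyFlux he₀ he hf.1 hD fun c hc => ?_⟩
  -- A flux within `c` of the infimum is enough: as the functional vanishes, the energy identity
  -- bounds its excess by `c`.
  have hlt : curveAction e T f < curveAction e T f + c := ENNReal.lt_add_right hA hc
  obtain ⟨U, hU⟩ := iInf_lt_iff.1 (show (⨅ (U : ℝ → SignedMeasure OffDiag) (_ : IsGCE e T f U),
    ∫⁻ t in Icc 0 T, action e (f t) (U t)) < _ from hlt)
  obtain ⟨hGU, hUc⟩ := iInf_lt_iff.1 hU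
  refine ⟨U, hGU, ?_⟩
  have hUA := (lt_top_of_lt hUc).ne
  obtain ⟨hX, hXe⟩ := hGU.action_add_dissipation_eq he₀ he hT hf hD hUA
  by_cases hct : c = ∞
  · rw [hct]; exact le_top
  have h1 := ENNReal.toReal_mono (ENNReal.add_ne_top.2 ⟨hA, hct⟩) hUc.le
  rw [ENNReal.toReal_add hA hct] at h1
  rw [← ENNReal.toReal_le_toReal hX hct]
  linarith

end Minimizers

end KineticAggregation

end

theorem mainTheorem3 (e : ℝ) (he₀ : 0 ≤ e) (he₁ : e < 1) (T : ℝ) (hT : 0 < T)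
    (f : ℝ → MeasureTheory.ProbabilityMeasure ℝ)
    (hf : KineticAggregation.IsACCurve e T f) :
    KineticAggregation.IsWeakSolution e T f ↔ KineticAggregation.deGiorgi e T f = 0 :=
  ⟨fun h => h.deGiorgi_eq_zero he₀ he₁ hT hf,
    KineticAggregation.isWeakSolution_of_deGiorgi_eq_zero he₀ he₁ hT hf⟩
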